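/- All theories are in the first-order language $\{\in\}$; two theories are called equal, $T_1=T_2$, if they have the same consequences (equivalently, prove the same sentences). In schemes, formulas may contain parameters, which are quantified universally. EST (Elementary Set Theory) consists of Extensionality, Empty Set, Pairing, Union, Cartesian Product (for all sets $a,b$ the set $a\times b$ exists), the scheme of $\Delta_0$-Separation, and the scheme of induction along $\omega$: for every formula $\phi(x)$ such that $\phi(x)$ implies $x\in\omega$, $$\big[\phi(\emptyset)\wedge(\forall x\in\omega)(\phi(x)\rightarrow\phi(x\cup\{x\}))\big]\rightarrow(\forall x\in\omega)\,\phi(x).$$ Here $x\in\omega$ abbreviates: $x$ is transitive and linearly ordered by $\in$, and every $y\in x\cup\{x\}$ is either $\emptyset$ or of the form $z\cup\{z\}$ with $z\in y$. ($\omega$ is not assumed to be a set.) For a set $A$, let $L_A$ be a first-order language, coded inside set theory, with equality, at most one unary predicate $U$, at most one binary predicate $R$, a constant $c_a$ for each $a\in A$, and the variables $v_i$, $i\in\omega$. An $L_A$-structure is a tuple $\langle M,U,R,I\rangle$ with $U\subseteq M$, $R\subseteq M\times M$ and $I:A\to M$ (interpreting $c_a$ by $I(a)$), where $U$ or $R$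 is omitted if it is not in the language. Satisfaction is the usual Tarskian relation, defined inside set theory by enumerating, along some $n\in\omega$, formulas $\sigma$ with variables among $v_0,\dots,v_{m-1}$ together with the sets of assignments in ${}^mM$ satisfying them, where ${}^mM$ is the set of tuples $\langle\langle 0,x_0\rangle,\dots,\langle m-1,x_{m-1}\rangle\rangle$ with $x_i\in M$. An $L_A$-elementary embedding is an injection between the domains that preserves the truth of all $L_A$-formulas in both directions. VP (Vopěnka's Principle) is the scheme that says, for every formula $\phi(x)$: for every set $A$, if $X_\phi=\{x:\phi(x)\}$ is a class of $L_A$-structures and is not a set, then there are $\mathcal M\neq\mathcal N$ in $X_\phi$ and an $L_A$-elementary embedding $f:\mathcal M\to\mathcal N$. ZF consists of Extensionality, Empty Set, Pairing, Union, Powerset, Infinity, Separation, Replacement and Foundation; AC is the Axiom of Choice, and ZFC is ZF + AC. Then $$\mathrm{EST}+\mathrm{Foundation}+\mathrm{VP}=\mathrm{ZF}+\mathrm{VP}\qquad\text{and}\qquad \mathrm{EST}+\mathrm{Foundation}+\mathrm{AC}+\mathrm{VP}=\mathrm{ZFC}+\mathrm{VP}.$$ -/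

import Mathlib

open FirstOrder

namespace VopenkaEST

/-! ## The language of set theory and a notation for its formulas -/

/-- The only symbol of the language of set theory: a binary relation symbol. -/
inductive SetRel : ℕ → Type
  | mem : SetRel 2

/-- The language `{∈}` of set theory. -/
def setLang : FirstOrder.Language.{0, 0} := ⟨fun _ => Empty, SetRel⟩

/-- The symbol `∈`. -/
def memSym : setLang.Relations 2 := SetRel.mem

/-- The atomic formula `t ∈ s`. -/
def memAtom {α : Type} {n : ℕ} (t s : setLang.Term (α ⊕ Fin n)) : setLang.BoundedFormula α n :=
  memSym.boundedFormula₂ t s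

/-- The `Δ₀` formulas: built from atomic formulas by propositional connectives and the bounded
quantifiers `∀ x ∈ v`, `∃ x ∈ v`, where `v` is a variable other than `x`. -/
inductive IsDelta0 {α : Type} : ∀ {n : ℕ}, setLang.BoundedFormula α n → Prop
  | falsum {n : ℕ} : IsDelta0 (⊥ : setLang.BoundedFormula α n)
  | equal {n : ℕ} (t s : setLang.Term (α ⊕ Fin n)) : IsDelta0 (t.bdEqual s)
  | mem {n : ℕ} (t s : setLang.Term (α ⊕ Fin n)) : IsDelta0 (memAtom t s)
  | imp {n : ℕ} {φ ψ : setLang.BoundedFormula α n} :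
      IsDelta0 φ → IsDelta0 ψ → IsDelta0 (φ.imp ψ)
  | ball {n : ℕ} (v : α ⊕ Fin n) {φ : setLang.BoundedFormula α (n + 1)} : IsDelta0 φ →
      IsDelta0 ((memAtom (FirstOrder.Language.Term.var (Sum.inr (Fin.last n)))
        (FirstOrder.Language.Term.var (Sum.map id Fin.castSucc v))).imp φ).all
  | bex {n : ℕ} (v : α ⊕ Fin n) {φ : setLang.BoundedFormula α (n + 1)} : IsDelta0 φ →
      IsDelta0 (memAtom (FirstOrder.Language.Term.var (Sum.inr (Fin.last n)))
        (FirstOrder.Language.Term.var (Sum.map id Fin.castSucc v)) ⊓ φ).ex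

/-- Formulas of set theory written with binders of Lean. Variables are numbers; an element `Φ` of
this type gives, for each `n`, the formula `Φ n` whose free variables are `0, …, n - 1`; a quantifier
met at depth `n` binds the variable number `n`. (A variable that is not in scope gives `⊥`; this
never happens in the formulas below.) -/
abbrev Fm : Type := (n : ℕ) → setLang.BoundedFormula Empty n

namespace Fm

/-- `x ∈ y` -/
def mem (x y : ℕ) : Fm := fun n =>
  if h : x < n ∧ y < n then
    memAtom (FirstOrder.Language.Term.var (Sum.inr ⟨x, h.1⟩)) (FirstOrder.Language.Term.var (Sum.inr ⟨y, h.2⟩))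
  else ⊥

/-- `x = y` -/
def eq (x y : ℕ) : Fm := fun n =>
  if h : x < n ∧ y < n then
    (FirstOrder.Language.Term.var (Sum.inr ⟨x, h.1⟩) : setLang.Term (Empty ⊕ Fin n)).bdEqual
      (FirstOrder.Language.Term.var (Sum.inr ⟨y, h.2⟩))
  else ⊥

open Classical in
/-- The formula `φ`, with the variable `vs i` in place of its free variable `i`. -/
noncomputable def inst {α : Type} (φ : setLang.Formula α) (vs : α → ℕ) : Fm := fun n =>
  if h : ∀ i, vs i < n then
    FirstOrder.Language.BoundedFormula.relabel (n := n) (k := 0)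
      (fun i => (Sum.inr ⟨vs i, h i⟩ : Empty ⊕ Fin n)) φ
  else ⊥

def falsum : Fm := fun _ => ⊥
def neg (Φ : Fm) : Fm := fun n => (Φ n).not
def and (Φ Ψ : Fm) : Fm := fun n => Φ n ⊓ Ψ n
def or (Φ Ψ : Fm) : Fm := fun n => Φ n ⊔ Ψ n
def imp (Φ Ψ : Fm) : Fm := fun n => (Φ n).imp (Ψ n)
def iff (Φ Ψ : Fm) : Fm := fun n => (Φ n).iff (Ψ n)
def all (Φ : ℕ → Fm) : Fm := fun n => (Φ n (n + 1)).all
def ex (Φ : ℕ → Fm) : Fm := fun n => (Φ n (n + 1)).ex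

end Fm

infixr:35 " ⋏ " => Fm.and
infixr:30 " ⋎ " => Fm.or
infixr:25 " ⟶ₛ " => Fm.imp
infix:20 " ⟷ₛ " => Fm.iff

namespace Fm

/-- `(∀ x ∈ a) Φ x` -/
def allIn (a : ℕ) (Φ : ℕ → Fm) : Fm := all fun x => mem x a ⟶ₛ Φ x

/-- `(∃ x ∈ a) Φ x` -/
def exIn (a : ℕ) (Φ : ℕ → Fm) : Fm := ex fun x => mem x a ⋏ Φ x

/-- The sentence given by `Φ`, where the first `k` variables are parameters (that is, they are
quantified universally). -/
def close (k : ℕ) (Φ : Fm) : setLang.Sentence := (Φ k).alls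

/-! ## Basic set-theoretic notions -/

/-- `x = ∅` -/
def isEmpty (x : ℕ) : Fm := allIn x fun _ => falsum

/-- `x ⊆ y` -/
def sub (x y : ℕ) : Fm := allIn x fun z => mem z y

/-- `p = {x, y}` -/
def isPair (p x y : ℕ) : Fm := mem x p ⋏ mem y p ⋏ allIn p fun z => eq z x ⋎ eq z y

/-- `p = ⟨x, y⟩ = {{x}, {x, y}}` -/
def isOPair (p x y : ℕ) : Fm :=
  exIn p fun s => exIn p fun t => isPair s x x ⋏ isPair t x y ⋏ isPair p s t

/-- `y = x ∪ {x}` -/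
def isSucc (y x : ℕ) : Fm := sub x y ⋏ mem x y ⋏ allIn y fun z => mem z x ⋎ eq z x

/-- `c = a × b` -/
def isProd (c a b : ℕ) : Fm :=
  all fun p => mem p c ⟷ₛ exIn a fun x => exIn b fun y => isOPair p x y

/-- `x` is a transitive set. -/
def tr (x : ℕ) : Fm := allIn x fun y => sub y x

/-- `x` is transitive and linearly ordered by `∈`. -/
def ord (x : ℕ) : Fm :=
  tr x ⋏ allIn x fun y => allIn x fun z => mem y z ⋎ eq y z ⋎ mem z y

/-- `x` is of the form `y ∪ {y}`. -/
def succ (x : ℕ) : Fm := exIn x fun y => isSucc x y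

/-- `x` is a natural number. -/
def nat (x : ℕ) : Fm :=
  ord x ⋏ all fun y => (mem y x ⋎ eq y x) ⟶ₛ (isEmpty y ⋎ succ y)

/-- `x` is the natural number `k`. -/
def isNum : ℕ → ℕ → Fm
  | 0, x => isEmpty x
  | k + 1, x => exIn x fun y => isNum k y ⋏ isSucc x y

/-- `⟨x, y⟩ ∈ f` (for a function `f`: `f(x) = y`) -/
def app (f x y : ℕ) : Fm := exIn f fun p => isOPair p x y

/-- `f` is a function with domain `d`. -/
def isFunOn (f d : ℕ) : Fm :=
  (allIn f fun p => exIn d fun x => ex fun y => isOPair p x y) ⋏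
  allIn d fun x => ex fun y => app f x y ⋏ all fun z => app f x z ⟶ₛ eq z y

/-- `f` is a function from `a` to `b`. -/
def isFun (f a b : ℕ) : Fm :=
  isFunOn f a ⋏ allIn a fun x => all fun y => app f x y ⟶ₛ mem y b

/-! ## Finite tuples

For `m ∈ ω`, the elements of `ᵐM` are the tuples `⟨⟨0, x₀⟩, …, ⟨m - 1, xₘ₋₁⟩⟩` with entries
`xᵢ ∈ M`, where tuples are nested to the left; the empty tuple is `∅`. -/

/-- `q` is the tuple `p` of length `i`, extended by the item `⟨i, x⟩`. -/
def append (q p i x : ℕ) : Fm :=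
  (isEmpty i ⋏ isOPair q i x) ⋎
  (neg (isEmpty i) ⋏ ex fun t => isOPair t i x ⋏ isOPair q p t)

/-- `p(i + 1)` is `p(i)` extended by `⟨i, x⟩`. -/
def step (p i x : ℕ) : Fm :=
  ex fun j => ex fun q => ex fun r => isSucc j i ⋏ app p i q ⋏ app p j r ⋏ append r q i x

/-- `p` is the sequence of length `m + 1` of the initial segments of the tuple `h` of length `m`. -/
def segments (p m h : ℕ) : Fm :=
  (ex fun d => isSucc d m ⋏ isFunOn p d) ⋏ (ex fun z => isEmpty z ⋏ app p z z) ⋏ app p m h ⋏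
  allIn m fun i => ex fun x => step p i x

/-- `h ∈ ᵐM` -/
def isTuple (h m M : ℕ) : Fm :=
  ex fun p => segments p m h ⋏ allIn m fun i => exIn M fun x => step p i x

/-- `h(i) = x`, for a tuple `h` of length `m` and `i < m` -/
def entry (h m i x : ℕ) : Fm := mem i m ⋏ ex fun p => segments p m h ⋏ step p i x

/-- `h' = h(i/x)`, for `h, h' ∈ ᵐM` -/
def isUpdate (h' h m i x : ℕ) : Fm :=
  entry h' m i x ⋏
  allIn m fun j => neg (eq j i) ⟶ₛ all fun y => entry h m j y ⟷ₛ entry h' m j y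

/-! ## The languages `L_A` inside set theory

`L_A` has a constant `c_a = ⟨1, a⟩` for each `a ∈ A`, the variables `v_i = ⟨0, i⟩`, `i ∈ ω`, the
logical symbols `≡, ¬, ∧, ∃`, coded by `2, 3, 4, 5`, a unary predicate `U`, coded by `6`, and a
binary predicate `R`, coded by `7`. Either or both of `U`, `R` may be missing: the Booleans `u` and
`r` say whether `U`, respectively `R`, is present. -/

/-- `t` is the variable `v_i`. -/
def isVar (t i : ℕ) : Fm := ex fun s => isNum 0 s ⋏ isOPair t s i

/-- `t` is the constant `c_a`. -/
def isConst (t a : ℕ) : Fm := ex fun s => isNum 1 s ⋏ isOPair t s a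

/-- `t` is a term of `L_A`, and it is `v_i` with `i < m` if it is a variable. -/
def isTerm (A m t : ℕ) : Fm := (exIn m fun i => isVar t i) ⋎ exIn A fun a => isConst t a

/-- `F = ⟨c, x⟩`, where `c` is a symbol (a numeral) -/
def code₁ (c F x : ℕ) : Fm := ex fun s => isNum c s ⋏ isOPair F s x

/-- `F = ⟨c, x, y⟩ = ⟨⟨c, x⟩, y⟩`, where `c` is a symbol (a numeral) -/
def code₂ (c F x y : ℕ) : Fm := ex fun q => code₁ c q x ⋏ isOPair F q y

/-- `Φ` if the Boolean is true, and `⊥` otherwise. -/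
def ifTrue (b : Bool) (Φ : Fm) : Fm := if b then Φ else falsum

/-- `f` is a function on `n ∈ ω` that enumerates formulas of `L_A` with all variables, free or bound,
among `v_0, …, v_{m-1}`: each value is atomic or comes from earlier values by `¬`, `∧` or `∃`. -/
def formSeq (u r : Bool) (A m f n : ℕ) : Fm :=
  nat n ⋏ isFunOn f n ⋏ allIn n fun k => ex fun F => app f k F ⋏
    ((ex fun t => ex fun s => isTerm A m t ⋏ isTerm A m s ⋏ code₂ 2 F t s) ⋎
     ifTrue u (ex fun t => isTerm A m t ⋏ code₁ 6 F t) ⋎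
     ifTrue r (ex fun t => ex fun s => isTerm A m t ⋏ isTerm A m s ⋏ code₂ 7 F t s) ⋎
     (exIn k fun j => ex fun G => app f j G ⋏ code₁ 3 F G) ⋎
     (exIn k fun j => exIn k fun l => ex fun G => ex fun H =>
        app f j G ⋏ app f l H ⋏ code₂ 4 F G H) ⋎
     (exIn m fun i => exIn k fun j => ex fun G => app f j G ⋏ code₂ 5 F i G))

/-- `σ` is the last value of the function `f` with domain `n`. -/
def lastVal (f n σ : ℕ) : Fm := ex fun l => isSucc n l ⋏ app f l σ

/-- `σ` is a formula of `L_A`, all of whose variables are among `v_0, …, v_{m-1}`. -/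
def isFormula (u r : Bool) (A m σ : ℕ) : Fm :=
  ex fun f => ex fun n => formSeq u r A m f n ⋏ lastVal f n σ

end Fm

/-- The (variables for the) domain, the interpretations of `U` and `R`, and the constant assignment
of an `L_A`-structure. -/
structure Str where
  M : ℕ
  U : ℕ
  R : ℕ
  I : ℕ

namespace Fm

/-- `y = ⟨x, c⟩` if the component `c` is present; otherwise `y = x`, and `c` is set to `∅`. -/
def addComp : Bool → ℕ → ℕ → ℕ → Fm
  | true, y, x, c => isOPair y x c
  | false, y, x, c => eq y x ⋏ isEmpty c

/-- `x` is the `L_A`-structure `⟨M, U, R, I⟩` (without `U` or `R` if these are not in the language):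
`U ⊆ M`, `R ⊆ M × M` and `I : A → M`. -/
def isStr (u r : Bool) (A x : ℕ) (S : Str) : Fm :=
  (ex fun y => ex fun z => addComp u y S.M S.U ⋏ addComp r z y S.R ⋏ isOPair x z S.I) ⋏
  sub S.U S.M ⋏
  (allIn S.R fun p => exIn S.M fun a => exIn S.M fun b => isOPair p a b) ⋏
  isFun S.I A S.M

/-- Quantification over the components of a structure. -/
def exStr (Φ : Str → Fm) : Fm :=
  ex fun M => ex fun U => ex fun R => ex fun I => Φ ⟨M, U, R, I⟩

/-- `x` is the value of the term `t` in the structure `S` under the assignment `h` of length `m`. -/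
def termVal (A m : ℕ) (S : Str) (t h x : ℕ) : Fm :=
  (exIn m fun i => isVar t i ⋏ entry h m i x) ⋎
  (exIn A fun a => isConst t a ⋏ app S.I a x)

/-- `G = {h ∈ ᵐM : Φ h}` -/
def isSep (G m M : ℕ) (Φ : ℕ → Fm) : Fm := all fun h => mem h G ⟷ₛ (isTuple h m M ⋏ Φ h)

/-- `g` gives, for each `k < n`, the set `g(k) ⊆ ᵐM` of the assignments that satisfy the formula
`f(k)` in the structure `S`. -/
def satSeq (u r : Bool) (A m : ℕ) (S : Str) (f g n : ℕ) : Fm :=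
  isFunOn g n ⋏ allIn n fun k => ex fun F => ex fun K => app f k F ⋏ app g k K ⋏
    ((ex fun t => ex fun s => isTerm A m t ⋏ isTerm A m s ⋏ code₂ 2 F t s ⋏
        isSep K m S.M fun h => ex fun x => termVal A m S t h x ⋏ termVal A m S s h x) ⋎
     ifTrue u (ex fun t => isTerm A m t ⋏ code₁ 6 F t ⋏
        isSep K m S.M fun h => exIn S.U fun x => termVal A m S t h x) ⋎
     ifTrue r (ex fun t => ex fun s => isTerm A m t ⋏ isTerm A m s ⋏ code₂ 7 F t s ⋏
        isSep K m S.M fun h => ex fun x => ex fun y =>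
          termVal A m S t h x ⋏ termVal A m S s h y ⋏ app S.R x y) ⋎
     (exIn k fun j => ex fun F' => ex fun K' => app f j F' ⋏ app g j K' ⋏ code₁ 3 F F' ⋏
        isSep K m S.M fun h => neg (mem h K')) ⋎
     (exIn k fun j => exIn k fun l => ex fun F' => ex fun K' => ex fun F'' => ex fun K'' =>
        app f j F' ⋏ app g j K' ⋏ app f l F'' ⋏ app g l K'' ⋏ code₂ 4 F F' F'' ⋏
        isSep K m S.M fun h => mem h K' ⋏ mem h K'') ⋎
     (exIn m fun i => exIn k fun j => ex fun F' => ex fun K' =>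
        app f j F' ⋏ app g j K' ⋏ code₂ 5 F i F' ⋏
        isSep K m S.M fun h => exIn S.M fun x => exIn K' fun h' => isUpdate h' h m i x))

/-- The structure `S` satisfies the formula `σ`, whose variables are among `v_0, …, v_{m-1}`, under
the assignment `e ∈ ᵐM`. -/
def sat (u r : Bool) (A m : ℕ) (S : Str) (σ e : ℕ) : Fm :=
  ex fun f => ex fun g => ex fun n => formSeq u r A m f n ⋏ lastVal f n σ ⋏
    satSeq u r A m S f g n ⋏ ex fun K => lastVal g n K ⋏ mem e K

/-- `f` is an `L_A`-elementary embedding of the structure `S` into the structure `T`: it is a 1-1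
function, and every formula has the same truth value at `e` in `S` and at `f ∘ e` in `T`, for all
`m ∈ ω`, all formulas with variables among `v_0, …, v_{m-1}` and all `e ∈ ᵐM`. As formulas with a
variable have no assignment in an empty `M`, this case is listed separately: a structure that
satisfies the same sentences as an empty one is empty. -/
def elemEmb (u r : Bool) (A f : ℕ) (S T : Str) : Fm :=
  isFun f S.M T.M ⋏
  (all fun x => all fun y => all fun z => (app f x z ⋏ app f y z) ⟶ₛ eq x y) ⋏
  (isEmpty S.M ⟶ₛ isEmpty T.M) ⋏
  all fun m => nat m ⟶ₛ all fun σ => isFormula u r A m σ ⟶ₛ all fun e => all fun e' =>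
    (isTuple e m S.M ⋏ isTuple e' m T.M ⋏
      (allIn m fun i => all fun x => all fun y => (entry e m i x ⋏ entry e' m i y) ⟶ₛ app f x y)) ⟶ₛ
    (sat u r A m S σ e ⟷ₛ sat u r A m T σ e')

/-- `φ(x)`, where the other free variables of `φ` stand for the parameters `0, …, k - 1`. -/
noncomputable def at₁ {k : ℕ} (φ : setLang.Formula (Fin k ⊕ Fin 1)) (x : ℕ) : Fm :=
  inst φ (Sum.elim (fun i => (i : ℕ)) ![x])

/-- `φ(x, y)`, where the other free variables of `φ` stand for the parameters `0, …, k - 1`. -/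
noncomputable def at₂ {k : ℕ} (φ : setLang.Formula (Fin k ⊕ Fin 2)) (x y : ℕ) : Fm :=
  inst φ (Sum.elim (fun i => (i : ℕ)) ![x, y])

end Fm

open Fm

/-! ## The axioms -/

def extAx : setLang.Sentence :=
  close 0 (all fun x => all fun y => (all fun z => mem z x ⟷ₛ mem z y) ⟶ₛ eq x y)

def emptyAx : setLang.Sentence := close 0 (ex fun x => isEmpty x)

def pairAx : setLang.Sentence := close 0 (all fun x => all fun y => ex fun p => isPair p x y)

def unionAx : setLang.Sentence :=
  close 0 (all fun x => ex fun w => all fun z => mem z w ⟷ₛ exIn x fun y => mem z y)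

def cartProdAx : setLang.Sentence :=
  close 0 (all fun a => all fun b => ex fun c => isProd c a b)

def powAx : setLang.Sentence :=
  close 0 (all fun x => ex fun w => all fun z => mem z w ⟷ₛ sub z x)

/-- Infinity: there is a set that contains `∅` and is closed under `y ↦ y ∪ {y}`. -/
def infAx : setLang.Sentence :=
  close 0 (ex fun x => (exIn x fun z => isEmpty z) ⋏ allIn x fun y => exIn x fun z => isSucc z y)

/-- Foundation: every nonempty set has an `∈`-minimal element. -/
def foundAx : setLang.Sentence :=
  close 0 (all fun x => neg (isEmpty x) ⟶ₛ exIn x fun y => allIn x fun z => neg (mem z y))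

/-- Choice: every set of nonempty sets has a choice function. -/
def choiceAx : setLang.Sentence :=
  close 0 (all fun x => (allIn x fun y => neg (isEmpty y)) ⟶ₛ
    ex fun f => isFunOn f x ⋏ allIn x fun y => all fun z => app f y z ⟶ₛ mem z y)

/-- The instance of Separation for `φ`, with `k` parameters. -/
noncomputable def sepAx {k : ℕ} (φ : setLang.Formula (Fin k ⊕ Fin 1)) : setLang.Sentence :=
  close k (all fun a => ex fun b => all fun x => mem x b ⟷ₛ (mem x a ⋏ at₁ φ x))

/-- The instance of Replacement for `φ`, with `k` parameters. -/
noncomputable def repAx {k : ℕ} (φ : setLang.Formula (Fin k ⊕ Fin 2)) : setLang.Sentence :=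
  close k (all fun a =>
    (allIn a fun x => all fun y => all fun z => (at₂ φ x y ⋏ at₂ φ x z) ⟶ₛ eq y z) ⟶ₛ
    ex fun b => all fun y => mem y b ⟷ₛ exIn a fun x => at₂ φ x y)

/-- The instance of induction along `ω` for `φ`, with `k` parameters. -/
noncomputable def indAx {k : ℕ} (φ : setLang.Formula (Fin k ⊕ Fin 1)) : setLang.Sentence :=
  close k ((all fun x => at₁ φ x ⟶ₛ nat x) ⟶ₛ
    ((all fun z => isEmpty z ⟶ₛ at₁ φ z) ⋏
      (all fun x => nat x ⟶ₛ at₁ φ x ⟶ₛ all fun y => isSucc y x ⟶ₛ at₁ φ y)) ⟶ₛ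
    all fun x => nat x ⟶ₛ at₁ φ x)

/-- The class `{x : φ(x)}` is proper, i.e. it is not a set. -/
noncomputable def properClass {k : ℕ} (φ : setLang.Formula (Fin k ⊕ Fin 1)) : Fm :=
  all fun x => ex fun y => (at₁ φ y ⋏ neg (mem y x)) ⋎ (neg (at₁ φ y) ⋏ mem y x)

/-- The instance of Vopěnka's Principle for `φ`, with `k` parameters: for every set `A`, if
`{x : φ(x)}` is a proper class of `L_A`-structures, then there are distinct structures in this class
and an `L_A`-elementary embedding of one into the other. -/
noncomputable def vopenkaAx (u r : Bool) {k : ℕ} (φ : setLang.Formula (Fin k ⊕ Fin 1)) :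
    setLang.Sentence :=
  close k (all fun A =>
    (properClass φ ⋏ all fun x => at₁ φ x ⟶ₛ exStr fun S => isStr u r A x S) ⟶ₛ
    ex fun x => ex fun y => neg (eq x y) ⋏ at₁ φ x ⋏ at₁ φ y ⋏
      exStr fun S => exStr fun T => isStr u r A x S ⋏ isStr u r A y T ⋏
        ex fun f => elemEmb u r A f S T)

/-! ## The theories -/

/-- Elementary Set Theory: Extensionality, Empty Set, Pairing, Union, Cartesian Product,
`Δ₀`-Separation and Induction along `ω`. -/
noncomputable def EST : setLang.Theory :=
  {extAx, emptyAx, pairAx, unionAx, cartProdAx} ∪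
  {σ | ∃ (k : ℕ) (φ : setLang.Formula (Fin k ⊕ Fin 1)), IsDelta0 φ ∧ σ = sepAx φ} ∪
  {σ | ∃ (k : ℕ) (φ : setLang.Formula (Fin k ⊕ Fin 1)), σ = indAx φ}

/-- Vopěnka's Principle. -/
noncomputable def VP : setLang.Theory :=
  {σ | ∃ (u r : Bool) (k : ℕ) (φ : setLang.Formula (Fin k ⊕ Fin 1)), σ = vopenkaAx u r φ}

/-- Zermelo–Fraenkel set theory. -/
noncomputable def ZF : setLang.Theory :=
  {extAx, emptyAx, pairAx, unionAx, powAx, infAx, foundAx} ∪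
  {σ | ∃ (k : ℕ) (φ : setLang.Formula (Fin k ⊕ Fin 1)), σ = sepAx φ} ∪
  {σ | ∃ (k : ℕ) (φ : setLang.Formula (Fin k ⊕ Fin 2)), σ = repAx φ}

/-- Zermelo–Fraenkel set theory with Choice. -/
noncomputable def ZFC : setLang.Theory := ZF ∪ {choiceAx}

/-- The sentences that follow from the theory `T`. -/
def consequences (T : setLang.Theory) : Set setLang.Sentence := {σ | T.ModelsBoundedFormula σ}

end VopenkaEST

/-! Consequence is semantic, so it suffices that `EST` + Foundation + `VP` and `ZF` + `VP` have the
same models. With Choice added to both sides nothing changes.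

From `EST` to `ZF`, what is missing is Separation, Power Set, Replacement and Infinity. The
contrapositive of VP is used: a class of structures with no elementary embedding between distinct
members is a set. Only atomic formulas are needed to rule out embeddings.

For the first three axioms, take structures ⟨M, U, id⟩ with U ⊆ A ⊆ M and a constant for each
element of A, interpreted by itself. An elementary embedding preserves every sentence U(c_a), so
both structures have the same U. If U determines M within the class, the class is therefore a set
(`exists_set_of_strU`). Separation uses ⟨a, {x}, id⟩ for the x ∈ a with φ(x), and a Δ₀ instance then
extracts the wanted subset. Power Set uses ⟨a, U, id⟩ for all U ⊆ a. Replacement uses ⟨a ∪ {y}, {x},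
id⟩ for x ∈ a and y = F(x). The values are then recovered from iterated unions.

For Infinity, code l ∈ ω, l ≠ 0, by the set l + 1 with the successor relation, a loop at 0 and a
pair ⟨l, 0⟩. An embedding preserves R(v_0, v_1), so it fixes 0 (the loop), hence by induction along
ω every x ≤ l, and then the pair ⟨l, 0⟩ forces equal lengths (`eq_of_elemEmb_chain`). So these
chains form a set, and Separation applied to an iterated union of that set yields ω.

From `ZF` to `EST`, products are found inside a double power set, and induction along ω follows from
Foundation applied to the set of counterexamples up to a given one (`models_EST_of_ZF`). -/

namespace VopenkaEST

/-! ## Semantics of the formulas of set theory -/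

section Update

variable {V : Type*} {n : ℕ} {v : ℕ → V}

theorem update_lt {x : ℕ} {a : V} (h : x < n) : Function.update v n a x = v x :=
  Function.update_of_ne h.ne _ _

theorem update_at {a : V} : Function.update v n a n = a := Function.update_self _ _ _

/-- Assignments are kept as total functions on ℕ of which only the first n values matter. Entering a
quantifier at depth n then becomes an `update` at n. -/
theorem snoc_update (a : V) :
    (Fin.snoc (fun i : Fin n => v i) a : Fin (n + 1) → V) =
      fun i : Fin (n + 1) => Function.update v n a i := by
  funext i
  refine Fin.lastCases ?_ (fun i => ?_) i
  · simp
  · simp [Function.update_of_ne i.2.ne]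

end Update

section Semantics

variable {V : Type*} [setLang.Structure V]

/-- Membership in a structure for the language of set theory. -/
def E (x y : V) : Prop := FirstOrder.Language.Structure.RelMap memSym ![x, y]

infix:50 " ε " => E

theorem realize_memAtom {α : Type} {n : ℕ} (t s : setLang.Term (α ⊕ Fin n)) (v : α → V)
    (w : Fin n → V) : (memAtom t s).Realize v w ↔
      t.realize (Sum.elim v w) ε s.realize (Sum.elim v w) :=
  FirstOrder.Language.BoundedFormula.realize_rel₂

/-- `Φ` holds in `V` when its free variables `0, …, n - 1` have the values `v 0, …, v (n - 1)`. -/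
def Real (Φ : Fm) (n : ℕ) (v : ℕ → V) : Prop := (Φ n).Realize default fun i : Fin n => v i

open Function (update)
open Fm

variable {n : ℕ} {v : ℕ → V}

/-- The bounds exclude the default value ⊥ of variables out of scope. They also guarantee that later
updates at n leave the values of x and y alone, so the translations below reduce to rewriting with
arithmetic side goals. -/
theorem real_mem {x y : ℕ} (hx : x < n) (hy : y < n) : Real (mem x y) n v ↔ v x ε v y := by
  simp [Real, mem, hx, hy, realize_memAtom]

theorem real_eq {x y : ℕ} (hx : x < n) (hy : y < n) : Real (eq x y) n v ↔ v x = v y := by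
  simp [Real, eq, hx, hy]

theorem real_falsum : Real falsum n v ↔ False := Iff.rfl

theorem real_neg {Φ : Fm} : Real (neg Φ) n v ↔ ¬ Real Φ n v := Iff.rfl

theorem real_imp {Φ Ψ : Fm} : Real (Φ ⟶ₛ Ψ) n v ↔ (Real Φ n v → Real Ψ n v) := Iff.rfl

theorem real_and {Φ Ψ : Fm} : Real (Φ ⋏ Ψ) n v ↔ Real Φ n v ∧ Real Ψ n v :=
  FirstOrder.Language.BoundedFormula.realize_inf

theorem real_or {Φ Ψ : Fm} : Real (Φ ⋎ Ψ) n v ↔ Real Φ n v ∨ Real Ψ n v :=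
  FirstOrder.Language.BoundedFormula.realize_sup

theorem real_iff {Φ Ψ : Fm} : Real (Φ ⟷ₛ Ψ) n v ↔ (Real Φ n v ↔ Real Ψ n v) :=
  FirstOrder.Language.BoundedFormula.realize_iff

theorem real_all {Φ : ℕ → Fm} :
    Real (all Φ) n v ↔ ∀ a, Real (Φ n) (n + 1) (update v n a) := by
  simp [Real, all, FirstOrder.Language.BoundedFormula.realize_all, snoc_update]

theorem real_ex {Φ : ℕ → Fm} :
    Real (ex Φ) n v ↔ ∃ a, Real (Φ n) (n + 1) (update v n a) := by
  simp [Real, ex, FirstOrder.Language.BoundedFormula.realize_ex, snoc_update]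

theorem real_allIn {a : ℕ} {Φ : ℕ → Fm} (ha : a < n) :
    Real (allIn a Φ) n v ↔ ∀ x, x ε v a → Real (Φ n) (n + 1) (update v n x) := by
  simp (disch := omega) only [allIn, real_all, real_imp, real_mem, update_lt, update_at]

theorem real_exIn {a : ℕ} {Φ : ℕ → Fm} (ha : a < n) :
    Real (exIn a Φ) n v ↔ ∃ x, x ε v a ∧ Real (Φ n) (n + 1) (update v n x) := by
  simp (disch := omega) only [exIn, real_ex, real_and, real_mem, update_lt, update_at]

theorem real_ifTrue {b : Bool} {Φ : Fm} : Real (ifTrue b Φ) n v ↔ b = true ∧ Real Φ n v := by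
  cases b <;> simp [ifTrue, real_falsum]

theorem real_inst {α : Type} {φ : setLang.Formula α} {vs : α → ℕ} (h : ∀ i, vs i < n) :
    Real (inst φ vs) n v ↔ φ.Realize fun i => v (vs i) := by
  simp only [Real, inst, h, implies_true, dite_true]
  refine FirstOrder.Language.BoundedFormula.realize_relabel.trans ?_
  rw [FirstOrder.Language.Formula.Realize]
  refine iff_of_eq (congrArg₂ _ ?_ (Subsingleton.elim _ _))
  funext i
  simp

theorem real_at₁ {k x : ℕ} {φ : setLang.Formula (Fin k ⊕ Fin 1)} (hk : k ≤ n) (hx : x < n) :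
    Real (at₁ φ x) n v ↔ φ.Realize (Sum.elim (fun i : Fin k => v i) ![v x]) := by
  rw [at₁, real_inst]
  · refine iff_of_eq (congrArg _ (funext ?_))
    rintro (i | i)
    · rfl
    · fin_cases i; rfl
  · rintro (i | i)
    · exact i.2.trans_le hk
    · fin_cases i; exact hx

theorem real_at₂ {k x y : ℕ} {φ : setLang.Formula (Fin k ⊕ Fin 2)} (hk : k ≤ n) (hx : x < n)
    (hy : y < n) :
    Real (at₂ φ x y) n v ↔ φ.Realize (Sum.elim (fun i : Fin k => v i) ![v x, v y]) := by
  rw [at₂, real_inst]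
  · refine iff_of_eq (congrArg _ (funext ?_))
    rintro (i | i)
    · rfl
    · fin_cases i <;> rfl
  · rintro (i | i)
    · exact i.2.trans_le hk
    · fin_cases i
      · exact hx
      · exact hy

theorem models_close [Nonempty V] {k : ℕ} {Φ : Fm} :
    V ⊨ close k Φ ↔ ∀ v : ℕ → V, Real Φ k v := by
  refine FirstOrder.Language.BoundedFormula.realize_alls.trans ⟨fun h v => h _, fun h xs => ?_⟩
  -- Only the values below k matter, so the tuple is padded arbitrarily.
  convert h fun i => if h : i < k then xs ⟨i, h⟩ else Classical.arbitrary V with i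
  refine iff_of_eq (congrArg₂ _ (Subsingleton.elim _ _) (funext fun i => ?_))
  simp

/-- A formula of set theory with `k + 1` variables, where the first `k` stand for parameters. -/
theorem exists_formula₁ (Φ : Fm) (k : ℕ) : ∃ φ : setLang.Formula (Fin k ⊕ Fin 1),
    ∀ (W : Type*) [setLang.Structure W] (v : ℕ → W) (x : W),
      φ.Realize (Sum.elim (fun i : Fin k => v i) ![x]) ↔ Real Φ (k + 1) (update v k x) := by
  refine ⟨(Φ (k + 1)).toFormula.relabel
    (Sum.elim Empty.elim (Fin.lastCases (Sum.inr 0) Sum.inl)), fun W _ v x => ?_⟩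
  rw [FirstOrder.Language.Formula.realize_relabel,
    FirstOrder.Language.BoundedFormula.realize_toFormula, Real]
  refine iff_of_eq (congrArg₂ _ (Subsingleton.elim _ _) (funext fun i => ?_))
  refine Fin.lastCases ?_ (fun i => ?_) i
  · simp
  · simp [Function.update_of_ne i.2.ne]

end Semantics

/-! ### Predicates on a structure that mirror the formulas clause by clause -/

section SemanticNotions

variable {V : Type*} [setLang.Structure V]

def Emp (x : V) : Prop := ∀ y, ¬ y ε x
def Sub (x y : V) : Prop := ∀ z, z ε x → z ε y
def IsPair (p x y : V) : Prop := x ε p ∧ y ε p ∧ ∀ z, z ε p → z = x ∨ z = y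
def IsOPair (p x y : V) : Prop :=
  ∃ s, s ε p ∧ ∃ t, t ε p ∧ IsPair s x x ∧ IsPair t x y ∧ IsPair p s t
def IsSucc (y x : V) : Prop := Sub x y ∧ x ε y ∧ ∀ z, z ε y → z ε x ∨ z = x
def IsProd (c a b : V) : Prop := ∀ p, p ε c ↔ ∃ x, x ε a ∧ ∃ y, y ε b ∧ IsOPair p x y
def Tr (x : V) : Prop := ∀ y, y ε x → Sub y x
def Ord (x : V) : Prop := Tr x ∧ ∀ y, y ε x → ∀ z, z ε x → y ε z ∨ y = z ∨ z ε y
def IsNat (x : V) : Prop :=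
  Ord x ∧ ∀ y, y ε x ∨ y = x → Emp y ∨ ∃ z, z ε y ∧ IsSucc y z
def Num : ℕ → V → Prop
  | 0, x => Emp x
  | k + 1, x => ∃ y, y ε x ∧ Num k y ∧ IsSucc x y
def App (f x y : V) : Prop := ∃ p, p ε f ∧ IsOPair p x y
def FunOn (f d : V) : Prop :=
  (∀ p, p ε f → ∃ x, x ε d ∧ ∃ y, IsOPair p x y) ∧
  ∀ x, x ε d → ∃ y, App f x y ∧ ∀ z, App f x z → z = y
def Fun (f a b : V) : Prop := FunOn f a ∧ ∀ x, x ε a → ∀ y, App f x y → y ε b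
def Append (q p i x : V) : Prop :=
  (Emp i ∧ IsOPair q i x) ∨ (¬ Emp i ∧ ∃ t, IsOPair t i x ∧ IsOPair q p t)
def Step (p i x : V) : Prop :=
  ∃ j q r, IsSucc j i ∧ App p i q ∧ App p j r ∧ Append r q i x
def Segments (p m h : V) : Prop :=
  (∃ d, IsSucc d m ∧ FunOn p d) ∧ (∃ z, Emp z ∧ App p z z) ∧ App p m h ∧
    ∀ i, i ε m → ∃ x, Step p i x
def Tuple (h m M : V) : Prop :=
  ∃ p, Segments p m h ∧ ∀ i, i ε m → ∃ x, x ε M ∧ Step p i x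
def Entry (h m i x : V) : Prop := i ε m ∧ ∃ p, Segments p m h ∧ Step p i x
def Update (h' h m i x : V) : Prop :=
  Entry h' m i x ∧ ∀ j, j ε m → ¬ j = i → ∀ y, Entry h m j y ↔ Entry h' m j y
def IsVar (t i : V) : Prop := ∃ s, Num 0 s ∧ IsOPair t s i
def IsConst (t a : V) : Prop := ∃ s, Num 1 s ∧ IsOPair t s a
def IsTerm (A m t : V) : Prop := (∃ i, i ε m ∧ IsVar t i) ∨ ∃ a, a ε A ∧ IsConst t a
def Code₁ (c : ℕ) (F x : V) : Prop := ∃ s, Num c s ∧ IsOPair F s x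
def Code₂ (c : ℕ) (F x y : V) : Prop := ∃ q, Code₁ c q x ∧ IsOPair F q y
def FormSeq (u r : Bool) (A m f n : V) : Prop :=
  IsNat n ∧ FunOn f n ∧ ∀ k, k ε n → ∃ F, App f k F ∧
    ((∃ t s, IsTerm A m t ∧ IsTerm A m s ∧ Code₂ 2 F t s) ∨
     (u = true ∧ ∃ t, IsTerm A m t ∧ Code₁ 6 F t) ∨
     (r = true ∧ ∃ t s, IsTerm A m t ∧ IsTerm A m s ∧ Code₂ 7 F t s) ∨
     (∃ j, j ε k ∧ ∃ G, App f j G ∧ Code₁ 3 F G) ∨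
     (∃ j, j ε k ∧ ∃ l, l ε k ∧ ∃ G H, App f j G ∧ App f l H ∧ Code₂ 4 F G H) ∨
     (∃ i, i ε m ∧ ∃ j, j ε k ∧ ∃ G, App f j G ∧ Code₂ 5 F i G))
def LastVal (f n σ : V) : Prop := ∃ l, IsSucc n l ∧ App f l σ
def IsFormula (u r : Bool) (A m σ : V) : Prop := ∃ f n, FormSeq u r A m f n ∧ LastVal f n σ

/-- The domain, the interpretations of `U` and `R`, and the constant assignment of a coded
structure. -/
structure SStr (V : Type*) where
  M : V
  U : V
  R : V
  I : V

/-- The values of the variables for the components of a structure. -/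
def Str.val (S : Str) (v : ℕ → V) : SStr V := ⟨v S.M, v S.U, v S.R, v S.I⟩

def AddComp : Bool → V → V → V → Prop
  | true, y, x, c => IsOPair y x c
  | false, y, x, c => y = x ∧ Emp c
def IsStr (u r : Bool) (A x : V) (S : SStr V) : Prop :=
  (∃ y z, AddComp u y S.M S.U ∧ AddComp r z y S.R ∧ IsOPair x z S.I) ∧ Sub S.U S.M ∧
  (∀ p, p ε S.R → ∃ a, a ε S.M ∧ ∃ b, b ε S.M ∧ IsOPair p a b) ∧ Fun S.I A S.M
def TermVal (A m : V) (S : SStr V) (t h x : V) : Prop :=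
  (∃ i, i ε m ∧ IsVar t i ∧ Entry h m i x) ∨ ∃ a, a ε A ∧ IsConst t a ∧ App S.I a x
def IsSep (G m M : V) (P : V → Prop) : Prop := ∀ h, h ε G ↔ Tuple h m M ∧ P h
def SatSeq (u r : Bool) (A m : V) (S : SStr V) (f g n : V) : Prop :=
  FunOn g n ∧ ∀ k, k ε n → ∃ F K, App f k F ∧ App g k K ∧
    ((∃ t s, IsTerm A m t ∧ IsTerm A m s ∧ Code₂ 2 F t s ∧
        IsSep K m S.M fun h => ∃ x, TermVal A m S t h x ∧ TermVal A m S s h x) ∨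
     (u = true ∧ ∃ t, IsTerm A m t ∧ Code₁ 6 F t ∧
        IsSep K m S.M fun h => ∃ x, x ε S.U ∧ TermVal A m S t h x) ∨
     (r = true ∧ ∃ t s, IsTerm A m t ∧ IsTerm A m s ∧ Code₂ 7 F t s ∧
        IsSep K m S.M fun h => ∃ x y, TermVal A m S t h x ∧ TermVal A m S s h y ∧ App S.R x y) ∨
     (∃ j, j ε k ∧ ∃ F' K', App f j F' ∧ App g j K' ∧ Code₁ 3 F F' ∧
        IsSep K m S.M fun h => ¬ h ε K') ∨
     (∃ j, j ε k ∧ ∃ l, l ε k ∧ ∃ F' K' F'' K'',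
        App f j F' ∧ App g j K' ∧ App f l F'' ∧ App g l K'' ∧ Code₂ 4 F F' F'' ∧
        IsSep K m S.M fun h => h ε K' ∧ h ε K'') ∨
     (∃ i, i ε m ∧ ∃ j, j ε k ∧ ∃ F' K', App f j F' ∧ App g j K' ∧ Code₂ 5 F i F' ∧
        IsSep K m S.M fun h => ∃ x, x ε S.M ∧ ∃ h', h' ε K' ∧ Update h' h m i x))
def Sat (u r : Bool) (A m : V) (S : SStr V) (σ e : V) : Prop :=
  ∃ f g n, FormSeq u r A m f n ∧ LastVal f n σ ∧ SatSeq u r A m S f g n ∧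
    ∃ K, LastVal g n K ∧ e ε K
def ElemEmb (u r : Bool) (A f : V) (S T : SStr V) : Prop :=
  Fun f S.M T.M ∧ (∀ x y z, App f x z ∧ App f y z → x = y) ∧ (Emp S.M → Emp T.M) ∧
  ∀ m, IsNat m → ∀ σ, IsFormula u r A m σ → ∀ e e',
    Tuple e m S.M ∧ Tuple e' m T.M ∧
      (∀ i, i ε m → ∀ x y, Entry e m i x ∧ Entry e' m i y → App f x y) →
    (Sat u r A m S σ e ↔ Sat u r A m T σ e')

end SemanticNotions

/-! ### Each formula expresses the corresponding predicate -/

section Realization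

variable {V : Type*} [setLang.Structure V] {n : ℕ} {v : ℕ → V}

open Function (update)
open Fm

theorem real_isEmpty {x : ℕ} (hx : x < n) :
    Real (isEmpty x) n v ↔ Emp (v x) := by
  simp (disch := omega) only [isEmpty, Emp, real_falsum, real_allIn]

theorem real_sub {x y : ℕ} (hx : x < n) (hy : y < n) :
    Real (sub x y) n v ↔ Sub (v x) (v y) := by
  simp (disch := omega) only [sub, Sub, real_mem, real_allIn, update_lt, update_at]

theorem real_isPair {p x y : ℕ} (hp : p < n) (hx : x < n) (hy : y < n) :
    Real (isPair p x y) n v ↔ IsPair (v p) (v x) (v y) := by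
  simp (disch := omega) only [isPair, IsPair, real_and, real_or, real_mem, real_eq, real_allIn,
    update_lt, update_at]

theorem real_isOPair {p x y : ℕ} (hp : p < n) (hx : x < n) (hy : y < n) :
    Real (isOPair p x y) n v ↔ IsOPair (v p) (v x) (v y) := by
  simp (disch := omega) only [isOPair, IsOPair, real_and, real_exIn, update_lt, update_at,
    real_isPair]

theorem real_isSucc {y x : ℕ} (hy : y < n) (hx : x < n) :
    Real (isSucc y x) n v ↔ IsSucc (v y) (v x) := by
  simp (disch := omega) only [isSucc, IsSucc, real_and, real_or, real_mem, real_eq, real_allIn,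
    update_lt, update_at, real_sub]

theorem real_isProd {c a b : ℕ} (hc : c < n) (ha : a < n) (hb : b < n) :
    Real (isProd c a b) n v ↔ IsProd (v c) (v a) (v b) := by
  simp (disch := omega) only [isProd, IsProd, real_iff, real_mem, real_all, real_exIn, update_lt,
    update_at, real_isOPair]

theorem real_tr {x : ℕ} (hx : x < n) :
    Real (tr x) n v ↔ Tr (v x) := by
  simp (disch := omega) only [tr, Tr, real_allIn, update_lt, update_at, real_sub]

theorem real_ord {x : ℕ} (hx : x < n) :
    Real (ord x) n v ↔ Ord (v x) := by
  simp (disch := omega) only [ord, Ord, real_and, real_or, real_mem, real_eq, real_allIn,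
    update_lt, update_at, real_tr]

theorem real_succ {x : ℕ} (hx : x < n) :
    Real (succ x) n v ↔ ∃ y, y ε v x ∧ IsSucc (v x) y := by
  simp (disch := omega) only [succ, real_exIn, update_lt, update_at, real_isSucc]

theorem real_nat {x : ℕ} (hx : x < n) :
    Real (nat x) n v ↔ IsNat (v x) := by
  simp (disch := omega) only [nat, IsNat, real_and, real_or, real_imp, real_mem, real_eq,
    real_all, update_lt, update_at, real_ord, real_isEmpty, real_succ]

theorem real_isNum {k x : ℕ} (hx : x < n) : Real (isNum k x) n v ↔ Num k (v x) := by
  induction k generalizing n v x with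
  | zero => exact real_isEmpty hx
  | succ k ih =>
    simp (disch := omega) only [isNum, Num, real_exIn, real_and, real_isSucc, ih, update_lt,
      update_at]
theorem real_app {f x y : ℕ} (hf : f < n) (hx : x < n) (hy : y < n) :
    Real (app f x y) n v ↔ App (v f) (v x) (v y) := by
  simp (disch := omega) only [app, App, real_exIn, update_lt, update_at, real_isOPair]

theorem real_isFunOn {f d : ℕ} (hf : f < n) (hd : d < n) :
    Real (isFunOn f d) n v ↔ FunOn (v f) (v d) := by
  simp (disch := omega) only [isFunOn, FunOn, real_and, real_imp, real_eq, real_all, real_ex,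
    real_allIn, real_exIn, update_lt, update_at, real_isOPair, real_app]

theorem real_isFun {f a b : ℕ} (hf : f < n) (ha : a < n) (hb : b < n) :
    Real (isFun f a b) n v ↔ Fun (v f) (v a) (v b) := by
  simp (disch := omega) only [isFun, Fun, real_and, real_imp, real_mem, real_all, real_allIn,
    update_lt, update_at, real_isFunOn, real_app]

theorem real_append {q p i x : ℕ} (hq : q < n) (hp : p < n) (hi : i < n) (hx : x < n) :
    Real (append q p i x) n v ↔ Append (v q) (v p) (v i) (v x) := by
  simp (disch := omega) only [append, Append, real_and, real_or, real_neg, real_ex, update_lt,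
    update_at, real_isEmpty, real_isOPair]

theorem real_step {p i x : ℕ} (hp : p < n) (hi : i < n) (hx : x < n) :
    Real (step p i x) n v ↔ Step (v p) (v i) (v x) := by
  simp (disch := omega) only [step, Step, real_and, real_ex, update_lt, update_at, real_isSucc,
    real_app, real_append]

theorem real_segments {p m h : ℕ} (hp : p < n) (hm : m < n) (hh : h < n) :
    Real (segments p m h) n v ↔ Segments (v p) (v m) (v h) := by
  simp (disch := omega) only [segments, Segments, real_and, real_ex, real_allIn, update_lt,
    update_at, real_isSucc, real_isFunOn, real_isEmpty, real_app, real_step]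

theorem real_isTuple {h m M : ℕ} (hh : h < n) (hm : m < n) (hM : M < n) :
    Real (isTuple h m M) n v ↔ Tuple (v h) (v m) (v M) := by
  simp (disch := omega) only [isTuple, Tuple, real_and, real_ex, real_allIn, real_exIn, update_lt,
    update_at, real_segments, real_step]

theorem real_entry {h m i x : ℕ} (hh : h < n) (hm : m < n) (hi : i < n) (hx : x < n) :
    Real (entry h m i x) n v ↔ Entry (v h) (v m) (v i) (v x) := by
  simp (disch := omega) only [entry, Entry, real_and, real_mem, real_ex, update_lt, update_at,
    real_segments, real_step]

theorem real_isUpdate {h' h m i x : ℕ} (hh' : h' < n) (hh : h < n) (hm : m < n) (hi : i < n) (hx :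
    x < n) :
    Real (isUpdate h' h m i x) n v ↔ Update (v h') (v h) (v m) (v i) (v x) := by
  simp (disch := omega) only [isUpdate, Update, real_and, real_imp, real_iff, real_neg, real_eq,
    real_all, real_allIn, update_lt, update_at, real_entry]

theorem real_isVar {t i : ℕ} (ht : t < n) (hi : i < n) :
    Real (isVar t i) n v ↔ IsVar (v t) (v i) := by
  simp (disch := omega) only [isVar, IsVar, real_and, real_ex, update_lt, update_at, real_isNum,
    real_isOPair]

theorem real_isConst {t a : ℕ} (ht : t < n) (ha : a < n) :
    Real (isConst t a) n v ↔ IsConst (v t) (v a) := by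
  simp (disch := omega) only [isConst, IsConst, real_and, real_ex, update_lt, update_at,
    real_isNum, real_isOPair]

theorem real_isTerm {A m t : ℕ} (hA : A < n) (hm : m < n) (ht : t < n) :
    Real (isTerm A m t) n v ↔ IsTerm (v A) (v m) (v t) := by
  simp (disch := omega) only [isTerm, IsTerm, real_or, real_exIn, update_lt, update_at,
    real_isVar, real_isConst]

theorem real_code₁ {c : ℕ} {F x : ℕ} (hF : F < n) (hx : x < n) :
    Real (code₁ c F x) n v ↔ Code₁ c (v F) (v x) := by
  simp (disch := omega) only [code₁, Code₁, real_and, real_ex, update_lt, update_at, real_isNum,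
    real_isOPair]

theorem real_code₂ {c : ℕ} {F x y : ℕ} (hF : F < n) (hx : x < n) (hy : y < n) :
    Real (code₂ c F x y) n v ↔ Code₂ c (v F) (v x) (v y) := by
  simp (disch := omega) only [code₂, Code₂, real_and, real_ex, update_lt, update_at, real_code₁,
    real_isOPair]

theorem real_formSeq {a b : Bool} {A m f k : ℕ} (hA : A < n) (hm : m < n) (hf : f < n) (hk : k <
    n) :
    Real (formSeq a b A m f k) n v ↔ FormSeq a b (v A) (v m) (v f) (v k) := by
  simp (disch := omega) only [formSeq, FormSeq, real_and, real_or, real_ex, real_allIn, real_exIn,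
    real_ifTrue, update_lt, update_at, real_nat, real_isFunOn, real_app, real_isTerm, real_code₁,
    real_code₂]

theorem real_lastVal {f k σ : ℕ} (hf : f < n) (hk : k < n) (hσ : σ < n) :
    Real (lastVal f k σ) n v ↔ LastVal (v f) (v k) (v σ) := by
  simp (disch := omega) only [lastVal, LastVal, real_and, real_ex, update_lt, update_at,
    real_isSucc, real_app]

theorem real_isFormula {a b : Bool} {A m σ : ℕ} (hA : A < n) (hm : m < n) (hσ : σ < n) :
    Real (isFormula a b A m σ) n v ↔ IsFormula a b (v A) (v m) (v σ) := by
  simp (disch := omega) only [isFormula, IsFormula, real_and, real_ex, update_lt, update_at,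
    real_formSeq, real_lastVal]

theorem real_addComp {b : Bool} {y x c : ℕ} (hy : y < n) (hx : x < n) (hc : c < n) :
    Real (addComp b y x c) n v ↔ AddComp b (v y) (v x) (v c) := by
  cases b <;> simp (disch := omega) only [addComp, AddComp, real_and, real_eq, real_isOPair,
    real_isEmpty]

theorem real_exStr {Φ : Str → Fm} : Real (exStr Φ) n v ↔ ∃ M U R I,
    Real (Φ ⟨n, n + 1, n + 2, n + 3⟩) (n + 4)
      (update (update (update (update v n M) (n + 1) U) (n + 2) R) (n + 3) I) := by
  simp only [exStr, real_ex]

theorem real_isStr {a b : Bool} {A x : ℕ} {S : Str} (hM : S.M < n) (hU : S.U < n) (hR : S.R < n)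
    (hI : S.I < n) (hA : A < n)
    (hx : x < n) :
    Real (isStr a b A x S) n v ↔ IsStr a b (v A) (v x) (S.val v) := by
  simp (disch := omega) only [isStr, IsStr, Str.val, real_and, real_ex, real_allIn, real_exIn,
    update_lt, update_at, real_addComp, real_isOPair, real_sub, real_isFun]

theorem real_termVal {A m t h x : ℕ} {S : Str} (hI : S.I < n) (hA : A < n) (hm : m < n)
    (ht : t < n) (hh : h < n) (hx : x < n) :
    Real (termVal A m S t h x) n v ↔ TermVal (v A) (v m) (S.val v) (v t) (v h) (v x) := by
  simp (disch := omega) only [termVal, TermVal, Str.val, real_and, real_or, real_exIn, update_lt,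
    update_at, real_isVar, real_entry, real_isConst, real_app]

theorem real_isSep {G m M : ℕ} {Φ : ℕ → Fm} (hG : G < n) (hm : m < n) (hM : M < n) :
    Real (isSep G m M Φ) n v ↔
      IsSep (v G) (v m) (v M) fun h => Real (Φ n) (n + 1) (update v n h) := by
  simp (disch := omega) only [isSep, IsSep, real_and, real_iff, real_mem, real_all, update_lt,
    update_at, real_isTuple]

theorem real_satSeq {a b : Bool} {A m f g k : ℕ} {S : Str} (hM : S.M < n) (hU : S.U < n) (hR : S.R
    < n) (hI : S.I < n)
    (hA : A < n) (hm : m < n) (hf : f < n) (hg : g < n) (hk : k < n) :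
    Real (satSeq a b A m S f g k) n v ↔
      SatSeq a b (v A) (v m) (S.val v) (v f) (v g) (v k) := by
  simp (disch := omega) only [satSeq, SatSeq, Str.val, real_and, real_or, real_neg, real_mem,
    real_ex, real_allIn, real_exIn, real_ifTrue, update_lt, update_at, real_isFunOn, real_app,
    real_isTerm, real_code₁, real_code₂, real_isSep, real_termVal, real_isUpdate]

theorem real_sat {a b : Bool} {A m σ e : ℕ} {S : Str} (hM : S.M < n) (hU : S.U < n) (hR : S.R < n)
    (hI : S.I < n)
    (hA : A < n) (hm : m < n) (hσ : σ < n) (he : e < n) :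
    Real (sat a b A m S σ e) n v ↔ Sat a b (v A) (v m) (S.val v) (v σ) (v e) := by
  simp (disch := omega) only [sat, Sat, Str.val, real_and, real_mem, real_ex, update_lt,
    update_at, real_formSeq, real_lastVal, real_satSeq]

theorem real_elemEmb {a b : Bool} {A f : ℕ} {S T : Str} (hM : S.M < n) (hU : S.U < n)
    (hR : S.R < n) (hI : S.I < n) (hM' : T.M < n) (hU' : T.U < n) (hR' : T.R < n) (hI' : T.I < n)
    (hA : A < n) (hf : f < n) :
    Real (elemEmb a b A f S T) n v ↔ ElemEmb a b (v A) (v f) (S.val v) (T.val v) := by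
  simp (disch := omega) only [elemEmb, ElemEmb, Str.val, real_and, real_imp, real_iff, real_eq,
    real_all, real_allIn, update_lt, update_at, real_isFun, real_app, real_isEmpty, real_nat,
    real_isFormula, real_isTuple, real_entry, real_sat]

theorem real_isStr_mk {a b : Bool} {A x M U R I : ℕ} (hM : M < n) (hU : U < n)
    (hR : R < n) (hI : I < n) (hA : A < n) (hx : x < n) :
    Real (isStr a b A x ⟨M, U, R, I⟩) n v ↔
      IsStr a b (v A) (v x) ⟨v M, v U, v R, v I⟩ :=
  real_isStr hM hU hR hI hA hx

theorem real_elemEmb_mk {a b : Bool} {A f M U R I M' U' R' I' : ℕ} (hM : M < n)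
    (hU : U < n) (hR : R < n) (hI : I < n) (hM' : M' < n) (hU' : U' < n) (hR' : R' < n)
    (hI' : I' < n) (hA : A < n) (hf : f < n) :
    Real (elemEmb a b A f ⟨M, U, R, I⟩ ⟨M', U', R', I'⟩) n v ↔
      ElemEmb a b (v A) (v f) ⟨v M, v U, v R, v I⟩ ⟨v M', v U', v R', v I'⟩ :=
  real_elemEmb hM hU hR hI hM' hU' hR' hI' hA hf

end Realization

theorem FunOn.unique {V : Type*} [setLang.Structure V] {f d x y z : V} (h : FunOn f d)
    (hx : x ε d) (hy : App f x y) (hz : App f x z) : y = z := by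
  obtain ⟨w, -, hw⟩ := h.2 x hx
  rw [hw y hy, hw z hz]

/-! ### Pairs, successors and numerals -/

section BasicSetTheory

/-- The axioms common to all the theories considered here. -/
class SetAx (V : Type*) [setLang.Structure V] : Prop where
  ext : ∀ x y : V, (∀ z, z ε x ↔ z ε y) → x = y
  empty : ∃ x : V, Emp x
  pair : ∀ x y : V, ∃ p, IsPair p x y
  union : ∀ x : V, ∃ w, ∀ z, z ε w ↔ ∃ y, y ε x ∧ z ε y
  found : ∀ x : V, ¬ Emp x → ∃ y, y ε x ∧ ∀ z, z ε x → ¬ z ε y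

variable {V : Type*} [setLang.Structure V] [SetAx V]

theorem set_ext {x y : V} (h : ∀ z, z ε x ↔ z ε y) : x = y := SetAx.ext x y h

/-- The empty set. -/
noncomputable def zero : V := Classical.choose (SetAx.empty (V := V))

/-- The unordered pair. -/
noncomputable def upair (x y : V) : V := Classical.choose (SetAx.pair x y)

/-- The union of the elements of a set. -/
noncomputable def sUn (x : V) : V := Classical.choose (SetAx.union x)

/-- The singleton. -/
noncomputable def sng (x : V) : V := upair x x

/-- The ordered pair. -/
noncomputable def opr (x y : V) : V := upair (sng x) (upair x y)

/-- The union of two sets. -/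
noncomputable def un (x y : V) : V := sUn (upair x y)

/-- The successor `x ∪ {x}`. -/
noncomputable def suc (x : V) : V := un x (sng x)

/-- The numerals. -/
noncomputable def num : ℕ → V
  | 0 => zero
  | k + 1 => suc (num k)

@[simp] theorem not_mem_zero (x : V) : ¬ x ε (zero : V) :=
  Classical.choose_spec (SetAx.empty (V := V)) x

@[simp] theorem mem_upair {x y z : V} : z ε upair x y ↔ z = x ∨ z = y := by
  have h := Classical.choose_spec (SetAx.pair x y)
  exact ⟨h.2.2 z, by rintro (rfl | rfl); exacts [h.1, h.2.1]⟩

@[simp] theorem mem_sUn {x z : V} : z ε sUn x ↔ ∃ y, y ε x ∧ z ε y :=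
  Classical.choose_spec (SetAx.union x) z

@[simp] theorem mem_sng {x z : V} : z ε sng x ↔ z = x := by simp [sng]

@[simp] theorem mem_un {x y z : V} : z ε un x y ↔ z ε x ∨ z ε y := by simp [un]

@[simp] theorem mem_suc {x z : V} : z ε suc x ↔ z ε x ∨ z = x := by simp [suc]

theorem emp_iff {x : V} : Emp x ↔ x = zero :=
  ⟨fun h => set_ext fun z => by simp [h z], by rintro rfl; exact not_mem_zero⟩

theorem isPair_iff {p x y : V} : IsPair p x y ↔ p = upair x y := by
  constructor
  · rintro ⟨h1, h2, h3⟩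
    refine set_ext fun z => ⟨fun h => mem_upair.2 (h3 z h), fun h => ?_⟩
    rcases mem_upair.1 h with rfl | rfl <;> assumption
  · rintro rfl
    simp [IsPair]

theorem sng_inj {x y : V} : sng x = sng y ↔ x = y := by
  refine ⟨fun h => mem_sng.1 ?_, fun h => h ▸ rfl⟩
  rw [← h, mem_sng]

theorem sng_eq_upair {x y z : V} : sng x = upair y z ↔ x = y ∧ x = z := by
  constructor
  · intro h
    have h1 : y ε sng x := by simp [h]
    have h2 : z ε sng x := by simp [h]
    exact ⟨(mem_sng.1 h1).symm, (mem_sng.1 h2).symm⟩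
  · rintro ⟨rfl, rfl⟩
    rfl

theorem upair_right_inj {x y z : V} (h : upair x y = upair x z) : y = z := by
  have h1 : y ε upair x z := h ▸ mem_upair.2 (Or.inr rfl)
  have h2 : z ε upair x y := h ▸ mem_upair.2 (Or.inr rfl)
  rw [mem_upair] at h1 h2
  grind

@[simp] theorem opr_inj {x y x' y' : V} : opr x y = opr x' y' ↔ x = x' ∧ y = y' := by
  refine ⟨fun h => ?_, fun h => by rw [h.1, h.2]⟩
  have hx : x = x' := by
    have h1 : sng x ε opr x' y' := h ▸ mem_upair.2 (Or.inl rfl)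
    rcases mem_upair.1 h1 with h1 | h1
    · exact sng_inj.1 h1
    · exact (sng_eq_upair.1 h1).1
  subst hx
  exact ⟨rfl, upair_right_inj (upair_right_inj h)⟩

theorem isOPair_iff {p x y : V} : IsOPair p x y ↔ p = opr x y := by
  simp only [IsOPair, isPair_iff]
  constructor
  · rintro ⟨s, -, t, -, rfl, rfl, rfl⟩
    rfl
  · rintro rfl
    exact ⟨_, mem_upair.2 (Or.inl rfl), _, mem_upair.2 (Or.inr rfl), rfl, rfl, rfl⟩

theorem isSucc_iff {y x : V} : IsSucc y x ↔ y = suc x := by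
  constructor
  · rintro ⟨h1, h2, h3⟩
    refine set_ext fun z => ⟨fun h => mem_suc.2 (h3 z h), fun h => ?_⟩
    rcases mem_suc.1 h with h | rfl
    exacts [h1 z h, h2]
  · rintro rfl
    exact ⟨fun z h => mem_suc.2 (Or.inl h), by simp, fun z => mem_suc.1⟩

theorem app_iff {f x y : V} : App f x y ↔ opr x y ε f := by
  simp [App, isOPair_iff]

/-- Foundation for {x, y}. This is what makes the successor injective and the numerals distinct. -/
theorem not_mem_symm {x y : V} (h : x ε y) : ¬ y ε x := by
  intro h'
  obtain ⟨z, hz, hz'⟩ := SetAx.found (upair x y) fun h => h x (mem_upair.2 (Or.inl rfl))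
  rcases mem_upair.1 hz with rfl | rfl
  · exact hz' y (by simp) h'
  · exact hz' x (by simp) h

theorem not_mem_self (x : V) : ¬ x ε x := fun h => not_mem_symm h h

@[simp] theorem suc_inj {x y : V} : suc x = suc y ↔ x = y := by
  refine ⟨fun h => ?_, fun h => h ▸ rfl⟩
  have h1 : x ε suc y := h ▸ mem_suc.2 (Or.inr rfl)
  have h2 : y ε suc x := h ▸ mem_suc.2 (Or.inr rfl)
  rcases mem_suc.1 h1 with h1 | h1
  · rcases mem_suc.1 h2 with h2 | h2
    · exact absurd h2 (not_mem_symm h1)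
    · exact h2.symm
  · exact h1

@[simp] theorem suc_ne_zero (x : V) : suc x ≠ zero := fun h =>
  not_mem_zero x (h ▸ mem_suc.2 (Or.inr rfl))

@[simp] theorem zero_ne_suc (x : V) : zero ≠ suc x := (suc_ne_zero x).symm

theorem suc_ne_self (x : V) : x ≠ suc x := fun h =>
  not_mem_self x (by conv => { rhs; rw [h] }
                     simp)

@[simp] theorem num_inj {i j : ℕ} : (num i : V) = num j ↔ i = j := by
  refine ⟨fun h => ?_, fun h => h ▸ rfl⟩
  induction i generalizing j with
  | zero => cases j <;> simp_all [num]
  | succ i ih =>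
    cases j with
    | zero => simp_all [num]
    | succ j => rw [ih (suc_inj.1 h)]

theorem zero_mem_num (k : ℕ) : (zero : V) ε num (k + 1) := by
  induction k with
  | zero => simp [num]
  | succ k ih => exact mem_suc.2 (Or.inl ih)

-- A nonzero numeral has the empty set as an element, whereas both elements of an ordered pair are
-- nonempty. This tells codes ⟨c, x⟩ apart from codes ⟨⟨c, x⟩, y⟩.
@[simp] theorem opr_ne_num {x y : V} {k : ℕ} : opr x y ≠ num k := by
  intro h
  cases k with
  | zero => exact not_mem_zero (sng x) (show sng x ε num 0 from h ▸ mem_upair.2 (Or.inl rfl))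
  | succ k =>
    have h0 := zero_mem_num (V := V) k
    rw [← h, opr, mem_upair] at h0
    rcases h0 with h0 | h0
    · exact not_mem_zero x (h0 ▸ mem_sng.2 rfl)
    · exact not_mem_zero x (h0 ▸ mem_upair.2 (Or.inl rfl))

@[simp] theorem num_ne_opr {x y : V} {k : ℕ} : num k ≠ opr x y := opr_ne_num.symm

theorem num_iff {k : ℕ} {x : V} : Num k x ↔ x = num k := by
  induction k generalizing x with
  | zero => exact emp_iff
  | succ k ih =>
    simp only [Num, ih, isSucc_iff, num]
    constructor
    · rintro ⟨_, -, rfl, rfl⟩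
      rfl
    · rintro rfl
      exact ⟨_, by simp, rfl, rfl⟩

theorem isNat_zero : IsNat (zero : V) := by
  simp [IsNat, Ord, Tr, emp_iff]

theorem IsNat.suc {x : V} (h : IsNat x) : IsNat (suc x) := by
  obtain ⟨⟨h1, h2⟩, h3⟩ := h
  refine ⟨⟨fun y hy z hz => ?_, fun y hy z hz => ?_⟩, ?_⟩
  · rcases mem_suc.1 hy with hy | rfl
    · exact mem_suc.2 (Or.inl (h1 y hy z hz))
    · exact mem_suc.2 (Or.inl hz)
  · rcases mem_suc.1 hy with hy | rfl <;> rcases mem_suc.1 hz with hz | rfl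
    · exact h2 y hy z hz
    · exact Or.inl hy
    · exact Or.inr (Or.inr hz)
    · exact Or.inr (Or.inl rfl)
  · rintro y (hy | rfl)
    · exact h3 y (mem_suc.1 hy)
    · exact Or.inr ⟨x, by simp, isSucc_iff.2 rfl⟩

theorem isNat_num (k : ℕ) : IsNat (num k : V) := by
  induction k with
  | zero => exact isNat_zero
  | succ k ih => exact ih.suc

theorem mem_one {x : V} : x ε num 1 ↔ x = num 0 := by simp [num]

theorem mem_two {x : V} : x ε num 2 ↔ x = num 0 ∨ x = num 1 := by simp [num]

/-! ### Functions and tuples -/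

theorem app_sng {x y z w : V} : App (sng (opr x y)) z w ↔ z = x ∧ w = y := by
  simp [app_iff]

theorem funOn_sng (x y : V) : FunOn (sng (opr x y)) (sng x) := by
  simp only [FunOn, mem_sng, app_sng, isOPair_iff]
  exact ⟨fun p hp => ⟨x, rfl, y, hp⟩, fun z hz => ⟨y, ⟨hz, rfl⟩, fun w hw => hw.2⟩⟩

theorem funOn_one (y : V) : FunOn (sng (opr (num 0) y)) (num 1) := by
  convert funOn_sng (num 0) y using 1
  exact set_ext fun z => by rw [mem_one, mem_sng]

/-- For length 0, the first and the last initial segment are the same value p(∅). -/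
theorem tuple_zero {h M : V} : Tuple h (num 0) M ↔ h = num 0 := by
  constructor
  · rintro ⟨p, ⟨⟨d, hd, hp⟩, ⟨z, hz, h1⟩, h2, -⟩, -⟩
    rw [emp_iff] at hz
    subst hz
    exact hp.unique (hd.2.1) h2 h1
  · rintro rfl
    refine ⟨sng (opr (num 0) (num 0)), ⟨⟨_, isSucc_iff.2 rfl, funOn_one _⟩,
      ⟨_, emp_iff.2 rfl, app_sng.2 ⟨rfl, rfl⟩⟩, app_sng.2 ⟨rfl, rfl⟩, ?_⟩, ?_⟩ <;>
    exact fun i hi => absurd hi (not_mem_zero i)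

/-- The tuple `⟨⟨0, x⟩, ⟨1, y⟩⟩`. -/
noncomputable def tup (x y : V) : V := opr (opr (num 0) x) (opr (num 1) y)

theorem tup_inj {x y x' y' : V} : tup x y = tup x' y' ↔ x = x' ∧ y = y' := by simp [tup]

/-- The initial segments of `tup x y`. -/
noncomputable def segs (x y : V) : V :=
  un (sng (opr (num 0) (num 0)))
    (upair (opr (num 1) (opr (num 0) x)) (opr (num 2) (tup x y)))

theorem app_segs {x y z w : V} : App (segs x y) z w ↔
    (z = num 0 ∧ w = num 0) ∨ (z = num 1 ∧ w = opr (num 0) x) ∨ z = num 2 ∧ w = tup x y := by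
  simp [app_iff, segs]

theorem mem_three {x : V} : x ε suc (num 2) ↔ x = num 0 ∨ x = num 1 ∨ x = num 2 := by
  rw [mem_suc, mem_two, or_assoc]

theorem funOn_segs (x y : V) : FunOn (segs x y) (suc (num 2)) := by
  constructor
  · intro p hp
    simp only [segs, mem_un, mem_sng, mem_upair] at hp
    simp only [isOPair_iff, mem_three]
    rcases hp with rfl | rfl | rfl <;> simp
  · intro z hz
    simp only [app_segs]
    rcases mem_three.1 hz with rfl | rfl | rfl <;> simp

theorem step_segs {x y i z : V} (hi : i ε num 2) :
    Step (segs x y) i z ↔ (i = num 0 ∧ z = x) ∨ (i = num 1 ∧ z = y) := by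
  have h1 : suc (num 0 : V) = num 1 := rfl
  have h2 : suc (num 1 : V) = num 2 := rfl
  have h0 : (zero : V) = num 0 := rfl
  simp only [Step, Append, isSucc_iff, isOPair_iff, app_segs, emp_iff, h0]
  rcases mem_two.1 hi with rfl | rfl <;> simp [h1, h2, tup, eq_comm]

theorem segments_segs (x y : V) : Segments (segs x y) (num 2) (tup x y) := by
  refine ⟨⟨_, isSucc_iff.2 rfl, funOn_segs x y⟩, ⟨num 0, emp_iff.2 rfl, app_segs.2 (by simp)⟩,
    app_segs.2 (by simp), fun i hi => ?_⟩
  rcases mem_two.1 hi with rfl | rfl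
  · exact ⟨x, (step_segs hi).2 (by simp)⟩
  · exact ⟨y, (step_segs hi).2 (by simp)⟩

/-- The recursion forces p(0) = ∅, p(1) = ⟨0, x⟩ and p(2) = ⟨⟨0, x⟩, ⟨1, y⟩⟩. Hence the existential
quantifiers over p in `Tuple` and `Entry` have only one possible witness. -/
theorem segments_two {p h : V} (hs : Segments p (num 2) h) : ∃ x y, p = segs x y ∧ h = tup x y := by
  obtain ⟨⟨d, hd, hp⟩, ⟨z, hz, h0⟩, h2, hstep⟩ := hs
  have e1 : suc (num 0 : V) = num 1 := rfl
  have e2 : suc (num 1 : V) = num 2 := rfl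
  rw [isSucc_iff] at hd
  obtain rfl : z = num 0 := emp_iff.1 hz
  subst hd
  obtain ⟨x, j, q, r, hj, hq, hr, ha⟩ := hstep (num 0) (mem_two.2 (Or.inl rfl))
  obtain ⟨y, j', q', r', hj', hq', hr', ha'⟩ := hstep (num 1) (mem_two.2 (Or.inr rfl))
  rw [isSucc_iff] at hj hj'
  rw [e1] at hj
  rw [e2] at hj'
  subst hj hj'
  have m1 : (num 1 : V) ε suc (num 2) := mem_three.2 (by simp)
  have m2 : (num 2 : V) ε suc (num 2) := mem_three.2 (by simp)
  have m0 : (num 0 : V) ε suc (num 2) := mem_three.2 (by simp)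
  obtain rfl := hp.unique m1 hr hq'
  obtain rfl := hp.unique m2 h2 hr'
  have hr1 : r = opr (num 0) x := by
    rcases ha with ha | ha
    · exact isOPair_iff.1 ha.2
    · exact absurd hz ha.1
  have hr2 : h = opr r (opr (num 1) y) := by
    rcases ha' with ha | ⟨-, t, ht, ha⟩
    · exact absurd (emp_iff.1 ha.1) (suc_ne_zero _)
    · rw [isOPair_iff] at ht ha
      rw [ha, ht]
  subst hr1
  -- Both are functions on {0, 1, 2}; having the same graph makes them equal, because functions
  -- consist of ordered pairs only.
  have key : ∀ i w, App p i w ↔ App (segs x y) i w := by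
    intro i w
    rw [app_segs]
    constructor
    · intro hi
      obtain ⟨p', hp', hp''⟩ := hi
      obtain ⟨i', hi', w', hw'⟩ := hp.1 p' hp'
      rw [isOPair_iff] at hp'' hw'
      have hi : App p i w := ⟨p', hp', isOPair_iff.2 hp''⟩
      obtain rfl : i = i' := (opr_inj.1 (hp''.symm.trans hw')).1
      rcases mem_three.1 hi' with rfl | rfl | rfl
      · exact Or.inl ⟨rfl, hp.unique m0 hi h0⟩
      · exact Or.inr (Or.inl ⟨rfl, hp.unique m1 hi hr⟩)
      · exact Or.inr (Or.inr ⟨rfl, (hp.unique m2 hi h2).trans hr2⟩)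
    · rintro (⟨rfl, rfl⟩ | ⟨rfl, rfl⟩ | ⟨rfl, rfl⟩)
      · exact h0
      · exact hr
      · rw [tup, ← hr2]
        exact h2
  refine ⟨x, y, set_ext fun q => ?_, hr2⟩
  constructor
  · intro hq
    obtain ⟨i, -, w, hw⟩ := hp.1 q hq
    rw [isOPair_iff] at hw
    subst hw
    exact app_iff.1 ((key i w).1 (app_iff.2 hq))
  · intro hq
    obtain ⟨i, -, w, hw⟩ := (funOn_segs x y).1 q hq
    rw [isOPair_iff] at hw
    subst hw
    exact app_iff.1 ((key i w).2 (app_iff.2 hq))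

theorem tuple_two {h M : V} : Tuple h (num 2) M ↔ ∃ x y, x ε M ∧ y ε M ∧ h = tup x y := by
  constructor
  · rintro ⟨p, hs, hM⟩
    obtain ⟨x, y, rfl, rfl⟩ := segments_two hs
    have m0 : (num 0 : V) ε num 2 := by simp [mem_two]
    have m1 : (num 1 : V) ε num 2 := by simp [mem_two]
    obtain ⟨x', hx', h0⟩ := hM _ m0
    obtain ⟨y', hy', h1⟩ := hM _ m1
    simp only [step_segs m0, step_segs m1, num_inj] at h0 h1
    simp only [true_and, zero_ne_one, one_ne_zero, false_and, or_false, false_or] at h0 h1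
    subst h0 h1
    exact ⟨_, _, hx', hy', rfl⟩
  · rintro ⟨x, y, hx, hy, rfl⟩
    refine ⟨segs x y, segments_segs x y, fun i hi => ?_⟩
    rcases mem_two.1 hi with rfl | rfl
    · exact ⟨x, hx, (step_segs hi).2 (by simp)⟩
    · exact ⟨y, hy, (step_segs hi).2 (by simp)⟩

theorem entry_tup {x y i z : V} :
    Entry (tup x y) (num 2) i z ↔ (i = num 0 ∧ z = x) ∨ (i = num 1 ∧ z = y) := by
  constructor
  · rintro ⟨hi, p, hs, hst⟩
    obtain ⟨x', y', rfl, he⟩ := segments_two hs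
    rw [tup_inj] at he
    rw [he.1, he.2]
    exact (step_segs hi).1 hst
  · intro h
    have hi : i ε num 2 := mem_two.2 (h.imp And.left And.left)
    exact ⟨hi, _, segments_segs x y, (step_segs hi).2 h⟩

/-! ### Satisfaction of atomic formulas -/

theorem code₁_iff {c : ℕ} {F x : V} : Code₁ c F x ↔ F = opr (num c) x := by
  simp [Code₁, num_iff, isOPair_iff]

theorem code₂_iff {c : ℕ} {F x y : V} : Code₂ c F x y ↔ F = opr (opr (num c) x) y := by
  simp [Code₂, code₁_iff, isOPair_iff]

theorem isVar_iff {t i : V} : IsVar t i ↔ t = opr (num 0) i := by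
  simp [IsVar, num_iff, isOPair_iff]

theorem isConst_iff {t a : V} : IsConst t a ↔ t = opr (num 1) a := by
  simp [IsConst, num_iff, isOPair_iff]

theorem isTerm_const {A m a : V} (ha : a ε A) : IsTerm A m (opr (num 1) a) :=
  Or.inr ⟨a, ha, isConst_iff.2 rfl⟩

theorem isTerm_var {A m i : V} (hi : i ε m) : IsTerm A m (opr (num 0) i) :=
  Or.inl ⟨i, hi, isVar_iff.2 rfl⟩

theorem termVal_const {A m a h x : V} {S : SStr V} :
    TermVal A m S (opr (num 1) a) h x ↔ a ε A ∧ App S.I a x := by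
  simp only [TermVal, isVar_iff, isConst_iff, opr_inj, num_inj]
  constructor
  · rintro (⟨i, -, h, -⟩ | ⟨a', h1, ⟨-, rfl⟩, h2⟩)
    · exact absurd h.1 one_ne_zero
    · exact ⟨h1, h2⟩
  · exact fun h => Or.inr ⟨a, h.1, ⟨trivial, rfl⟩, h.2⟩

theorem termVal_var {A m i h x : V} {S : SStr V} :
    TermVal A m S (opr (num 0) i) h x ↔ Entry h m i x := by
  simp only [TermVal, isVar_iff, isConst_iff, opr_inj, num_inj]
  constructor
  · rintro (⟨i, -, ⟨-, rfl⟩, h⟩ | ⟨a', h1, h, h2⟩)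
    · exact h
    · exact absurd h.1 zero_ne_one
  · exact fun h => Or.inl ⟨i, h.1, ⟨trivial, rfl⟩, h⟩

theorem lastVal_one (σ : V) : LastVal (sng (opr (num 0) σ)) (num 1) σ :=
  ⟨num 0, isSucc_iff.2 rfl, app_sng.2 ⟨rfl, rfl⟩⟩

theorem formSeq_U (r : Bool) {A m t : V} (ht : IsTerm A m t) :
    FormSeq true r A m (sng (opr (num 0) (opr (num 6) t))) (num 1) := by
  refine ⟨isNat_num 1, funOn_one _, fun k hk => ⟨_, app_sng.2 ⟨mem_one.1 hk, rfl⟩, ?_⟩⟩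
  exact Or.inr (Or.inl ⟨rfl, t, ht, code₁_iff.2 rfl⟩)

theorem formSeq_R (u : Bool) {A m t s : V} (ht : IsTerm A m t) (hs : IsTerm A m s) :
    FormSeq u true A m (sng (opr (num 0) (opr (opr (num 7) t) s))) (num 1) := by
  refine ⟨isNat_num 1, funOn_one _, fun k hk => ⟨_, app_sng.2 ⟨mem_one.1 hk, rfl⟩, ?_⟩⟩
  exact Or.inr (Or.inr (Or.inl ⟨rfl, t, s, ht, hs, code₂_iff.2 rfl⟩))

theorem isFormula_U (r : Bool) {A m t : V} (ht : IsTerm A m t) :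
    IsFormula true r A m (opr (num 6) t) := ⟨_, _, formSeq_U r ht, lastVal_one _⟩

theorem isFormula_R (u : Bool) {A m t s : V} (ht : IsTerm A m t) (hs : IsTerm A m s) :
    IsFormula u true A m (opr (opr (num 7) t) s) := ⟨_, _, formSeq_R u ht hs, lastVal_one _⟩

/-- The enumerations are functions, so at the last index l the formula is exactly σ and the set of
assignments exactly K. This allows the clause that holds at l to be read off from the code of σ. -/
theorem sat_last {u r : Bool} {A m σ e : V} {S : SStr V} (h : Sat u r A m S σ e) :
    ∃ f g n l K, FormSeq u r A m f n ∧ SatSeq u r A m S f g n ∧ l ε n ∧ e ε K ∧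
      (∀ F, App f l F ↔ F = σ) ∧ ∀ K', App g l K' ↔ K' = K := by
  obtain ⟨f, g, n, hf, ⟨l, hl, hσ⟩, hg, K, ⟨l', hl', hK⟩, he⟩ := h
  obtain rfl : l = l' := suc_inj.1 ((isSucc_iff.1 hl).symm.trans (isSucc_iff.1 hl'))
  refine ⟨f, g, n, l, K, hf, hg, hl.2.1, he, fun F => ⟨fun h => hf.2.1.unique hl.2.1 h hσ, ?_⟩,
    fun F => ⟨fun h => hg.1.unique hl.2.1 h hK, ?_⟩⟩
  · rintro rfl
    exact hσ
  · rintro rfl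
    exact hK

/-- Whatever the enumeration, its last clause decides satisfaction. Conversely the enumeration of
length one is a witness, provided that the set of satisfying assignments exists, which is what `hK`
supplies. -/
theorem sat_U {r : Bool} {A m t e : V} {S : SStr V} (ht : IsTerm A m t)
    (hK : ∃ K, IsSep K m S.M fun h => ∃ x, x ε S.U ∧ TermVal A m S t h x) :
    Sat true r A m S (opr (num 6) t) e ↔
      Tuple e m S.M ∧ ∃ x, x ε S.U ∧ TermVal A m S t e x := by
  constructor
  · intro h
    obtain ⟨f, g, n, l, K, hf, hg, hl, he, hσ, hK'⟩ := sat_last h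
    obtain ⟨F, K', hF, hK'', h⟩ := hg.2 l hl
    rw [hσ] at hF
    rw [hK'] at hK''
    subst hF hK''
    -- The leading symbol 6 and the shape of the code rule out every clause but the one for U.
    simp only [code₁_iff, code₂_iff, opr_inj, num_inj, num_ne_opr] at h
    simp only [false_and, and_false, exists_false, false_or, or_false, Nat.reduceEqDiff,
      true_and] at h
    obtain ⟨t', ht', rfl, h⟩ := h
    exact (h e).1 he
  · intro h
    obtain ⟨K, hK⟩ := hK
    refine ⟨_, sng (opr (num 0) K), num 1, formSeq_U r ht, lastVal_one _,
      ⟨funOn_one _, fun k hk => ⟨_, K, app_sng.2 ⟨mem_one.1 hk, rfl⟩, app_sng.2 ⟨mem_one.1 hk, rfl⟩,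
        Or.inr (Or.inl ⟨rfl, t, ht, code₁_iff.2 rfl, hK⟩)⟩⟩, K, lastVal_one _, (hK e).2 h⟩

theorem sat_R {u : Bool} {A m t s e : V} {S : SStr V} (ht : IsTerm A m t) (hs : IsTerm A m s)
    (hK : ∃ K, IsSep K m S.M fun h =>
      ∃ x y, TermVal A m S t h x ∧ TermVal A m S s h y ∧ App S.R x y) :
    Sat u true A m S (opr (opr (num 7) t) s) e ↔
      Tuple e m S.M ∧ ∃ x y, TermVal A m S t e x ∧ TermVal A m S s e y ∧ App S.R x y := by
  constructor
  · intro h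
    obtain ⟨f, g, n, l, K, hf, hg, hl, he, hσ, hK'⟩ := sat_last h
    obtain ⟨F, K', hF, hK'', h⟩ := hg.2 l hl
    rw [hσ] at hF
    rw [hK'] at hK''
    subst hF hK''
    simp only [code₁_iff, code₂_iff, opr_inj, num_inj, opr_ne_num] at h
    simp only [false_and, and_false, exists_false, false_or, or_false, Nat.reduceEqDiff,
      true_and] at h
    obtain ⟨t', s', ht', hs', ⟨rfl, rfl⟩, h⟩ := h
    exact (h e).1 he
  · intro h
    obtain ⟨K, hK⟩ := hK
    refine ⟨_, sng (opr (num 0) K), num 1, formSeq_R u ht hs, lastVal_one _,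
      ⟨funOn_one _, fun k hk => ⟨_, K, app_sng.2 ⟨mem_one.1 hk, rfl⟩, app_sng.2 ⟨mem_one.1 hk, rfl⟩,
        Or.inr (Or.inr (Or.inl ⟨rfl, t, s, ht, hs, code₂_iff.2 rfl, hK⟩))⟩⟩,
      K, lastVal_one _, (hK e).2 h⟩

/-- Truth of the sentence `U(c_a)`. -/
theorem sat_U_const {r : Bool} {A a : V} {S : SStr V} (ha : a ε A) :
    Sat true r A (num 0) S (opr (num 6) (opr (num 1) a)) (num 0) ↔
      ∃ x, x ε S.U ∧ App S.I a x := by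
  rw [sat_U (isTerm_const ha)]
  · simp [termVal_const, ha, tuple_zero]
  · simp only [IsSep, termVal_const, tuple_zero, ha, true_and]
    -- The only assignment of length 0 is ∅, so the set is {∅} or ∅ and exists without any instance
    -- of Separation.
    by_cases h : ∃ x, x ε S.U ∧ App S.I a x
    · exact ⟨sng (num 0), fun h' => by simp [h]⟩
    · exact ⟨zero, fun h' => by simp [h]⟩

/-- Truth of the formula `R(v_0, v_1)`. -/
theorem sat_R_var {u : Bool} {A x y : V} {S : SStr V} (hx : x ε S.M) (hy : y ε S.M)
    (hK : ∃ K, ∀ h, h ε K ↔ ∃ x y, x ε S.M ∧ y ε S.M ∧ h = tup x y ∧ App S.R x y) :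
    Sat u true A (num 2) S (opr (opr (num 7) (opr (num 0) (num 0))) (opr (num 0) (num 1)))
      (tup x y) ↔ App S.R x y := by
  have m0 : (num 0 : V) ε num 2 := by simp [mem_two]
  have m1 : (num 1 : V) ε num 2 := by simp [mem_two]
  have key : ∀ x y, (∃ z w, Entry (tup x y) (num 2) (num 0) z ∧
      Entry (tup x y) (num 2) (num 1) w ∧ App S.R z w) ↔ App S.R x y := by
    intro x y
    simp [entry_tup]
  rw [sat_R (isTerm_var m0) (isTerm_var m1)]
  · simp only [termVal_var, key, tuple_two]
    exact ⟨fun h => h.2, fun h => ⟨⟨x, y, hx, hy, rfl⟩, h⟩⟩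
  · obtain ⟨K, hK⟩ := hK
    refine ⟨K, fun h => ?_⟩
    simp only [termVal_var, tuple_two, hK]
    constructor
    · rintro ⟨x, y, hx, hy, rfl, h⟩
      exact ⟨⟨x, y, hx, hy, rfl⟩, (key x y).2 h⟩
    · rintro ⟨⟨x, y, hx, hy, rfl⟩, h⟩
      exact ⟨x, y, hx, hy, rfl, (key x y).1 h⟩

end BasicSetTheory

/-! ## Definable classes -/

section Definability

variable {V : Type*} [setLang.Structure V]

open Function (update)
open Fm

/-- The class `C` is definable with parameters. -/
def DefClass (C : V → Prop) : Prop :=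
  ∃ (k : ℕ) (φ : setLang.Formula (Fin k ⊕ Fin 1)) (v : ℕ → V),
    ∀ x, φ.Realize (Sum.elim (fun i : Fin k => v i) ![x]) ↔ C x

/-- The binary relation `F` is definable with parameters. -/
def DefRel (F : V → V → Prop) : Prop :=
  ∃ (k : ℕ) (φ : setLang.Formula (Fin k ⊕ Fin 2)) (v : ℕ → V),
    ∀ x y, φ.Realize (Sum.elim (fun i : Fin k => v i) ![x, y]) ↔ F x y

theorem defClass_of_real {C : V → Prop} (Φ : Fm) (k : ℕ) (v : ℕ → V)
    (h : ∀ x, Real Φ (k + 1) (update v k x) ↔ C x) : DefClass C := by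
  obtain ⟨φ, hφ⟩ := exists_formula₁ Φ k
  exact ⟨k, φ, v, fun x => (hφ V v x).trans (h x)⟩

/-- Makes a definition usable inside larger formulas: Φ may occur at any depth n ≥ k, as long as the
first k variables still hold the parameters. -/
theorem DefClass.exists_real {C : V → Prop} (h : DefClass C) : ∃ (k : ℕ) (v : ℕ → V) (Φ : ℕ → Fm),
    ∀ (n : ℕ) (w : ℕ → V) (x : ℕ), k ≤ n → x < n → (∀ i < k, w i = v i) →
      (Real (Φ x) n w ↔ C (w x)) := by
  obtain ⟨k, φ, v, h⟩ := h
  refine ⟨k, v, at₁ φ, fun n w x hk hx hw => ?_⟩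
  rw [real_at₁ hk hx, ← h]
  simp only [hw _ (Fin.is_lt _)]

theorem DefRel.exists_real {F : V → V → Prop} (h : DefRel F) :
    ∃ (k : ℕ) (v : ℕ → V) (Φ : ℕ → ℕ → Fm),
      ∀ (n : ℕ) (w : ℕ → V) (x y : ℕ), k ≤ n → x < n → y < n → (∀ i < k, w i = v i) →
        (Real (Φ x y) n w ↔ F (w x) (w y)) := by
  obtain ⟨k, φ, v, h⟩ := h
  refine ⟨k, v, at₂ φ, fun n w x y hk hx hy hw => ?_⟩
  rw [real_at₂ hk hx hy, ← h]
  simp only [hw _ (Fin.is_lt _)]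

end Definability

/-! ## Definability by `Δ₀` formulas -/

section Lift

variable {V : Type*} {α : Type} {n : ℕ}

/-- A variable, seen in the scope of one more quantifier. -/
def lift (x : α ⊕ Fin n) : α ⊕ Fin (n + 1) := Sum.map id Fin.castSucc x

@[simp] theorem elim_lift (v : α → V) (w : Fin n → V) (z : V) (x : α ⊕ Fin n) :
    Sum.elim v (Fin.snoc w z : Fin (n + 1) → V) (lift x) = Sum.elim v w x := by
  cases x <;> simp [lift]

@[simp] theorem elim_last (v : α → V) (w : Fin n → V) (z : V) :
    Sum.elim v (Fin.snoc w z : Fin (n + 1) → V) (Sum.inr (Fin.last n)) = z := by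
  simp

end Lift

section DeltaZero

variable {V : Type*} [setLang.Structure V] {α : Type} {n : ℕ}

/-- The relation `P` is defined by a `Δ₀` formula. -/
def D0 (P : (α → V) → (Fin n → V) → Prop) : Prop :=
  ∃ φ : setLang.BoundedFormula α n, IsDelta0 φ ∧ ∀ v w, φ.Realize v w ↔ P v w

theorem D0.mem (x y : α ⊕ Fin n) :
    D0 fun (v : α → V) (w : Fin n → V) => Sum.elim v w x ε Sum.elim v w y :=
  ⟨_, .mem (.var x) (.var y), fun v w => realize_memAtom _ _ v w⟩

theorem D0.eq (x y : α ⊕ Fin n) :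
    D0 fun (v : α → V) (w : Fin n → V) => Sum.elim v w x = Sum.elim v w y :=
  ⟨_, .equal (.var x) (.var y), fun v w => by simp⟩

theorem D0.imp {P Q : (α → V) → (Fin n → V) → Prop} : D0 P → D0 Q →
    D0 fun v w => P v w → Q v w := by
  rintro ⟨φ, hφ, h⟩ ⟨ψ, hψ, h'⟩
  exact ⟨_, hφ.imp hψ, fun v w => by simp [h, h']⟩

theorem D0.and {P Q : (α → V) → (Fin n → V) → Prop} : D0 P → D0 Q →
    D0 fun v w => P v w ∧ Q v w := by
  rintro ⟨φ, hφ, h⟩ ⟨ψ, hψ, h'⟩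
  -- `⊓` unfolds to (φ → (ψ → ⊥)) → ⊥, which the generators of `IsDelta0` cover.
  exact ⟨φ ⊓ ψ, (hφ.imp (hψ.imp .falsum)).imp .falsum, fun v w => by simp [h, h']⟩

theorem D0.or {P Q : (α → V) → (Fin n → V) → Prop} : D0 P → D0 Q →
    D0 fun v w => P v w ∨ Q v w := by
  rintro ⟨φ, hφ, h⟩ ⟨ψ, hψ, h'⟩
  exact ⟨φ ⊔ ψ, (hφ.imp .falsum).imp hψ, fun v w => by simp [h, h']⟩

theorem D0.ball (x : α ⊕ Fin n) {P : (α → V) → (Fin (n + 1) → V) → Prop} : D0 P →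
    D0 fun v w => ∀ z, z ε Sum.elim v w x → P v (Fin.snoc w z) := by
  rintro ⟨φ, hφ, h⟩
  refine ⟨_, hφ.ball x, fun v w => ?_⟩
  rw [FirstOrder.Language.BoundedFormula.realize_all]
  refine forall_congr' fun z => ?_
  rw [FirstOrder.Language.BoundedFormula.realize_imp, realize_memAtom, h]
  exact imp_congr_left (by rw [← elim_lift v w z x]; simp [lift])

theorem D0.bex (x : α ⊕ Fin n) {P : (α → V) → (Fin (n + 1) → V) → Prop} : D0 P →
    D0 fun v w => ∃ z, z ε Sum.elim v w x ∧ P v (Fin.snoc w z) := by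
  rintro ⟨φ, hφ, h⟩
  refine ⟨_, hφ.bex x, fun v w => ?_⟩
  rw [FirstOrder.Language.BoundedFormula.realize_ex]
  refine exists_congr fun z => ?_
  rw [FirstOrder.Language.BoundedFormula.realize_inf, realize_memAtom, h]
  exact and_congr_left' (by rw [← elim_lift v w z x]; simp [lift])

theorem D0.isPair (p x y : α ⊕ Fin n) :
    D0 fun (v : α → V) (w : Fin n → V) =>
      IsPair (Sum.elim v w p) (Sum.elim v w x) (Sum.elim v w y) := by
  have h := (D0.mem (V := V) x p).and ((D0.mem y p).and (D0.ball p
    ((D0.eq (Sum.inr (Fin.last n)) (lift x)).or (D0.eq (Sum.inr (Fin.last n)) (lift y)))))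
  simpa only [elim_lift, elim_last, IsPair] using h

theorem D0.isOPair (p x y : α ⊕ Fin n) :
    D0 fun (v : α → V) (w : Fin n → V) =>
      IsOPair (Sum.elim v w p) (Sum.elim v w x) (Sum.elim v w y) := by
  have h := D0.bex (V := V) p (D0.bex (lift p)
    ((D0.isPair (lift (Sum.inr (Fin.last n))) (lift (lift x)) (lift (lift x))).and
      ((D0.isPair (Sum.inr (Fin.last (n + 1))) (lift (lift x)) (lift (lift y))).and
        (D0.isPair (lift (lift p)) (lift (Sum.inr (Fin.last n))) (Sum.inr (Fin.last (n + 1)))))))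
  simpa only [elim_lift, elim_last, IsOPair] using h

end DeltaZero

/-! ## Consequences of Vopěnka's Principle -/

section Vopenka

/-- The models of `EST + Foundation + VP`. -/
class EstVP (V : Type*) [setLang.Structure V] : Prop extends SetAx V where
  prod : ∀ a b : V, ∃ c, IsProd c a b
  sep₀ : ∀ (k : ℕ) (φ : setLang.Formula (Fin k ⊕ Fin 1)) (v : Fin k → V), IsDelta0 φ → ∀ a : V,
    ∃ b, ∀ x, x ε b ↔ x ε a ∧ φ.Realize (Sum.elim v ![x])
  ind : ∀ C : V → Prop, DefClass C → (∀ x, C x → IsNat x) → C zero →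
    (∀ x, IsNat x → C x → C (suc x)) → ∀ x, IsNat x → C x
  vopenka : ∀ (u r : Bool) (A : V) (C : V → Prop), DefClass C →
    (∀ x, C x → ∃ S, IsStr u r A x S) → (¬ ∃ b, ∀ x, x ε b ↔ C x) →
      ∃ x y, x ≠ y ∧ C x ∧ C y ∧ ∃ S T, IsStr u r A x S ∧ IsStr u r A y T ∧
        ∃ f, ElemEmb u r A f S T

variable {V : Type*} [setLang.Structure V] [EstVP V]

open Function (update)
open Fm

theorem D0.exists_set {k : ℕ} {P : (Fin k ⊕ Fin 1 → V) → (Fin 0 → V) → Prop} (h : D0 P)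
    (v : Fin k → V) (a : V) : ∃ b, ∀ x, x ε b ↔ x ε a ∧ P (Sum.elim v ![x]) default := by
  obtain ⟨φ, hφ, h⟩ := h
  obtain ⟨b, hb⟩ := EstVP.sep₀ k φ v hφ a
  exact ⟨b, fun x => by rw [hb, ← h]; rfl⟩

/-- Full Separation is not yet available. But a pair ⟨x, y⟩ lies on the diagonal iff any two of its
elements are equal, and this is Δ₀. -/
theorem exists_id (a : V) : ∃ f, ∀ p, p ε f ↔ ∃ x, x ε a ∧ p = opr x x := by
  obtain ⟨c, hc⟩ := EstVP.prod a a
  obtain ⟨f, hf⟩ := (D0.ball (V := V) (Sum.inl (Sum.inr 0) : (Fin 0 ⊕ Fin 1) ⊕ Fin 0)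
    (D0.ball (Sum.inl (Sum.inr 0)) (D0.eq (Sum.inr 0) (Sum.inr 1)))).exists_set Fin.elim0 c
  refine ⟨f, fun p => ?_⟩
  have h1 : p ε f ↔ p ε c ∧ ∀ s, s ε p → ∀ t, t ε p → s = t := hf p
  rw [h1, hc]
  simp only [isOPair_iff]
  constructor
  · rintro ⟨⟨x, hx, y, hy, rfl⟩, h⟩
    have := h _ (mem_upair.2 (Or.inl rfl)) _ (mem_upair.2 (Or.inr rfl))
    obtain rfl := (sng_eq_upair.1 this).2
    exact ⟨x, hx, rfl⟩
  · rintro ⟨x, hx, rfl⟩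
    refine ⟨⟨x, hx, x, hx, rfl⟩, fun s hs t ht => ?_⟩
    have h2 : ∀ s, s ε opr x x → s = sng x := fun s hs => (mem_upair.1 hs).elim id id
    rw [h2 s hs, h2 t ht]

/-- The identity on `a`. -/
noncomputable def idf (a : V) : V := Classical.choose (exists_id a)

theorem app_idf {a x y : V} : App (idf a) x y ↔ x ε a ∧ y = x := by
  rw [app_iff, idf, Classical.choose_spec (exists_id a)]
  constructor
  · rintro ⟨z, hz, h⟩
    obtain ⟨rfl, rfl⟩ := opr_inj.1 h
    exact ⟨hz, rfl⟩
  · rintro ⟨h, rfl⟩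
    exact ⟨y, h, rfl⟩

theorem fun_idf {a M : V} (h : Sub a M) : Fun (idf a) a M := by
  refine ⟨⟨fun p hp => ?_, fun x hx => ⟨x, app_idf.2 ⟨hx, rfl⟩, fun z hz => (app_idf.1 hz).2⟩⟩,
    fun x hx y hy => (app_idf.1 hy).2 ▸ h x hx⟩
  obtain ⟨x, hx, rfl⟩ := (Classical.choose_spec (exists_id a) p).1 hp
  exact ⟨x, hx, x, isOPair_iff.2 rfl⟩

/-- The structure `⟨M, U, I⟩`, without a binary relation, where `I` is the identity on `A`. -/
noncomputable def strU (A M U : V) : V := opr (opr M U) (idf A)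

theorem isStr_strU {A M U : V} (hA : Sub A M) (hU : Sub U M) :
    IsStr true false A (strU A M U) ⟨M, U, zero, idf A⟩ :=
  ⟨⟨_, _, isOPair_iff.2 rfl, ⟨rfl, not_mem_zero⟩, isOPair_iff.2 rfl⟩, hU,
    fun p hp => absurd hp (not_mem_zero p), fun_idf hA⟩

theorem IsStr.of_strU {A A' M U : V} {S : SStr V} (h : IsStr true false A (strU A' M U) S) :
    S.M = M ∧ S.U = U ∧ S.I = idf A' := by
  obtain ⟨⟨y, z, h1, ⟨rfl, -⟩, h2⟩, -⟩ := h
  have h1 := isOPair_iff.1 h1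
  subst h1
  simpa [strU, eq_comm, and_assoc] using isOPair_iff.1 h2

theorem tuple_zero' (M : V) : Tuple (num 0) (num 0) M := tuple_zero.2 rfl

/-- A class of structures `⟨M, U, id⟩` with constants for the elements of `A ⊇ U`, in which each
structure is determined by `U`, is a set. -/
theorem exists_set_of_strU {C : V → Prop} (hC : DefClass C) {A : V}
    (h : ∀ x, C x → ∃ M U, x = strU A M U ∧ Sub A M ∧ Sub U A)
    (hU : ∀ M M' U, C (strU A M U) → C (strU A M' U) → M = M') :
    ∃ b, ∀ x, x ε b ↔ C x := by
  -- A proper class would give, by VP, an embedding between two distinct members.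
  by_contra hb
  obtain ⟨x, y, hne, hx, hy, S, T, hS, hT, f, hf⟩ := EstVP.vopenka true false A C hC (fun x hx => by
    obtain ⟨M, U, rfl, hA, hU⟩ := h x hx
    exact ⟨_, isStr_strU hA fun z hz => hA z (hU z hz)⟩) hb
  obtain ⟨M, U, rfl, hA, hUA⟩ := h x hx
  obtain ⟨M', U', rfl, hA', hUA'⟩ := h y hy
  obtain ⟨-, hSU, hSI⟩ := hS.of_strU
  obtain ⟨-, hTU, hTI⟩ := hT.of_strU
  -- Elementarity for the sentence U(c_c), evaluated at the empty tuple; c_c denotes c in both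
  -- structures.
  have key : ∀ c, c ε A → (c ε U ↔ c ε U') := by
    intro c hc
    have := hf.2.2.2 (num 0) (isNat_num 0) _ (isFormula_U false (isTerm_const hc)) (num 0) (num 0)
      ⟨tuple_zero' _, tuple_zero' _, fun i hi => absurd hi (not_mem_zero i)⟩
    simpa [sat_U_const hc, hSU, hSI, hTU, hTI, app_idf, hc] using this
  obtain rfl : U = U' := set_ext fun z =>
    ⟨fun hz => (key z (hUA z hz)).1 hz, fun hz => (key z (hUA' z hz)).2 hz⟩
  exact hne (by rw [hU M M' U hx hy])

/-! ### Separation, Power Set and Replacement -/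

theorem mem_sUn_of_opr {x y s : V} (h : opr x y ε s) : x ε sUn (sUn s) ∧ y ε sUn (sUn s) := by
  simp only [mem_sUn]
  have h1 : upair x y ε opr x y := mem_upair.2 (Or.inr rfl)
  exact ⟨⟨_, ⟨_, h, h1⟩, by simp⟩, ⟨_, ⟨_, h, h1⟩, by simp⟩⟩

/-- VP turns the class of structures ⟨a, {x}, id⟩ with x ∈ a and C(x) into a set s. Then C(x) is
equivalent, for x ∈ a, to a Δ₀ condition with s as a parameter. -/
theorem separation {C : V → Prop} (hC : DefClass C) (a : V) : ∃ b, ∀ x, x ε b ↔ x ε a ∧ C x := by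
  obtain ⟨s, hs⟩ := exists_set_of_strU
    (C := fun X => ∃ x, x ε a ∧ C x ∧ X = strU a a (sng x)) (A := a) (by
      obtain ⟨k, v, Φ, hΦ⟩ := hC.exists_real
      refine defClass_of_real (exIn k fun x => Φ x ⋏ ex fun u => ex fun q =>
        isPair u x x ⋏ isOPair q k u ⋏ isOPair (k + 2) q (k + 1)) (k + 2)
        (update (update v k a) (k + 1) (idf a)) fun X => ?_
      rw [real_exIn (by omega)]
      simp (disch := omega) only [real_and, real_ex, real_isPair, real_isOPair, update_lt,
        update_at, isPair_iff, isOPair_iff]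
      refine exists_congr fun x => and_congr_right fun _ => and_congr ?_ ?_
      · rw [hΦ _ _ _ (by omega) (by omega), update_at]
        intro i hi
        simp (disch := omega) only [update_lt]
      · simp [strU, sng])
    (by
      rintro X ⟨x, hx, -, rfl⟩
      exact ⟨a, sng x, rfl, fun z => id, fun z hz => mem_sng.1 hz ▸ hx⟩)
    (by
      rintro M M' U ⟨x, -, -, h⟩ ⟨x', -, -, h'⟩
      simp only [strU, opr_inj] at h h'
      rw [h.1.1, h'.1.1])
  -- The condition ⟨⟨a, {x}⟩, id⟩ ∈ s, with the quantifiers over the structure, its inner pair and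
  -- {x} bounded by s, ⋃⋃s and ⋃⋃⋃⋃s. These three sets, id and a are the five parameters.
  have hD := D0.bex (V := V) (Sum.inl (Sum.inl 0) : (Fin 5 ⊕ Fin 1) ⊕ Fin 0)
    (D0.bex (Sum.inl (Sum.inl 1)) (D0.bex (Sum.inl (Sum.inl 2))
      ((D0.isOPair (Sum.inr 0) (Sum.inr 1) (Sum.inl (Sum.inl 3))).and
        ((D0.isOPair (Sum.inr 1) (Sum.inl (Sum.inl 4)) (Sum.inr 2)).and
          (D0.isPair (Sum.inr 2) (Sum.inl (Sum.inr 0)) (Sum.inl (Sum.inr 0)))))))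
  obtain ⟨b, hb⟩ := hD.exists_set
    ![s, sUn (sUn s), sUn (sUn (sUn (sUn s))), idf a, a] a
  refine ⟨b, fun x => ?_⟩
  have h1 : x ε b ↔ x ε a ∧ ∃ X, X ε s ∧ ∃ q, q ε sUn (sUn s) ∧
      ∃ u, u ε sUn (sUn (sUn (sUn s))) ∧
        IsOPair X q (idf a) ∧ IsOPair q a u ∧ IsPair u x x := hb x
  rw [h1]
  refine and_congr_right fun hx => ?_
  simp only [isOPair_iff, isPair_iff]
  constructor
  · rintro ⟨_, hX, _, -, _, -, rfl, rfl, rfl⟩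
    obtain ⟨y, -, hy, h⟩ := (hs _).1 hX
    simp only [strU, opr_inj, true_and, and_true] at h
    rwa [sng_inj.1 h]
  · intro h
    have h2 := (hs _).2 ⟨x, hx, h, rfl⟩
    have h3 := (mem_sUn_of_opr h2).1
    exact ⟨_, h2, _, h3, _, (mem_sUn_of_opr h3).2, rfl, rfl, rfl⟩

/-- All structures here have domain a, so U determines the structure. Each U ⊆ a sits two ordered
pairs deep, hence in the fourfold union. -/
theorem power_set (a : V) : ∃ b, ∀ x, x ε b ↔ Sub x a := by
  obtain ⟨s, hs⟩ := exists_set_of_strU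
    (C := fun X => ∃ U, Sub U a ∧ X = strU a a U) (A := a) (by
      refine defClass_of_real (ex fun u => sub u 0 ⋏ ex fun q =>
        isOPair q 0 u ⋏ isOPair 2 q 1) 2 (update (update (fun _ => a) 0 a) 1 (idf a)) fun X => ?_
      simp (disch := omega) only [real_and, real_ex, real_sub, real_isOPair, update_lt,
        update_at, isOPair_iff]
      simp [strU])
    (by
      rintro X ⟨U, hU, rfl⟩
      exact ⟨a, U, rfl, fun z => id, hU⟩)
    (by
      rintro M M' U ⟨x, -, h⟩ ⟨x', -, h'⟩
      simp only [strU, opr_inj] at h h'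
      rw [h.1.1, h'.1.1])
  obtain ⟨b, hb⟩ := separation (C := fun x => Sub x a)
    (defClass_of_real (sub 1 0) 1 (fun _ => a) fun x => by
      simp (disch := omega) only [real_sub, update_lt, update_at])
    (sUn (sUn (sUn (sUn s))))
  refine ⟨b, fun x => (hb x).trans (and_iff_right_of_imp fun hx => ?_)⟩
  exact (mem_sUn_of_opr (mem_sUn_of_opr ((hs _).2 ⟨x, hx, rfl⟩)).1).2

/-- The value y is hidden in the domain a ∪ {y} and its argument x in U = {x}. Functionality of F
makes U determine the domain. -/
theorem replacement {F : V → V → Prop} (hF : DefRel F) (a : V)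
    (hfun : ∀ x, x ε a → ∀ y z, F x y → F x z → y = z) :
    ∃ b, ∀ y, y ε b ↔ ∃ x, x ε a ∧ F x y := by
  obtain ⟨k, v, Φ, hΦ⟩ := hF.exists_real
  obtain ⟨s, hs⟩ := exists_set_of_strU
    (C := fun X => ∃ x, x ε a ∧ ∃ y, F x y ∧ X = strU a (un a (sng y)) (sng x)) (A := a) (by
      refine defClass_of_real (exIn k fun x => ex fun y => Φ x y ⋏ ex fun M => ex fun u =>
        ex fun q => (all fun z => mem z M ⟷ₛ (mem z k ⋎ eq z y)) ⋏ isPair u x x ⋏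
          isOPair q M u ⋏ isOPair (k + 2) q (k + 1)) (k + 2)
        (update (update v k a) (k + 1) (idf a)) fun X => ?_
      rw [real_exIn (by omega)]
      simp (disch := omega) only [real_and, real_ex, real_all, real_iff, real_mem, real_or, real_eq,
        real_isPair, real_isOPair, update_lt, update_at, isPair_iff, isOPair_iff]
      refine exists_congr fun x => and_congr_right fun _ => exists_congr fun y => and_congr ?_ ?_
      · rw [hΦ _ _ _ _ (by omega) (by omega) (by omega), update_at, update_lt (by omega), update_at]
        intro i hi
        simp (disch := omega) only [update_lt]
      · constructor
        · rintro ⟨M, _, _, hM, rfl, rfl, rfl⟩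
          obtain rfl : M = un a (sng y) := set_ext fun z => by simp [hM]
          rfl
        · rintro rfl
          exact ⟨_, _, _, fun z => by simp, rfl, rfl, rfl⟩)
    (by
      rintro X ⟨x, hx, y, -, rfl⟩
      exact ⟨_, sng x, rfl, fun z hz => mem_un.2 (Or.inl hz), fun z hz => mem_sng.1 hz ▸ hx⟩)
    (by
      rintro M M' U ⟨x, hx, y, hy, h⟩ ⟨x', -, y', hy', h'⟩
      simp only [strU, opr_inj, and_true] at h h'
      obtain rfl := sng_inj.1 (h.2.symm.trans h'.2)
      rw [h.1, h'.1, hfun x hx y y' hy hy'])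
  obtain ⟨b, hb⟩ := separation (C := fun y => ∃ x, x ε a ∧ F x y)
    (defClass_of_real (exIn k fun x => Φ x (k + 1)) (k + 1) (update v k a) fun y => by
      rw [real_exIn (by omega)]
      simp (disch := omega) only [update_lt, update_at]
      refine exists_congr fun x => and_congr_right fun _ => ?_
      rw [hΦ _ _ _ _ (by omega) (by omega) (by omega), update_at, update_lt (by omega), update_at]
      intro i hi
      simp (disch := omega) only [update_lt])
    -- Four unions reach the domain a ∪ {y}, a fifth reaches y.
    (sUn (sUn (sUn (sUn (sUn s)))))
  refine ⟨b, fun y => (hb y).trans (and_iff_right_of_imp ?_)⟩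
  rintro ⟨x, hx, hy⟩
  exact mem_sUn.2 ⟨_, (mem_sUn_of_opr (mem_sUn_of_opr ((hs _).2 ⟨x, hx, y, hy, rfl⟩)).1).1,
    by simp⟩

/-! ### Infinity -/

/-- The relation that codes the natural number `l` as a structure on `l + 1`: the successor function
on `l`, and two more pairs that mark `0` and `l`. -/
def chainRel (l x y : V) : Prop := y = suc x ∨ y = zero ∧ (x = zero ∨ x = l)

/-- `r` is the restriction of `chainRel l` to `l + 1`. -/
def IsChain (l r : V) : Prop :=
  ∀ p, p ε r ↔ ∃ x, x ε suc l ∧ ∃ y, y ε suc l ∧ p = opr x y ∧ chainRel l x y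

theorem exists_isChain (l : V) : ∃ r, IsChain l r := by
  obtain ⟨c, hc⟩ := EstVP.prod (suc l) (suc l)
  obtain ⟨r, hr⟩ := separation (C := fun p => ∃ x y, p = opr x y ∧ chainRel l x y)
    (defClass_of_real (ex fun x => ex fun y => isOPair 1 x y ⋏
      (isSucc y x ⋎ (isEmpty y ⋏ (isEmpty x ⋎ eq x 0)))) 1 (fun _ => l) fun p => by
        simp (disch := omega) only [real_and, real_ex, real_or, real_eq, real_isEmpty, real_isSucc,
          real_isOPair, update_lt, update_at, isOPair_iff, isSucc_iff, emp_iff, chainRel]) c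
  refine ⟨r, fun p => (hr p).trans ?_⟩
  rw [hc]
  simp only [isOPair_iff]
  constructor
  · rintro ⟨⟨x, hx, y, hy, rfl⟩, x', y', h, h'⟩
    obtain ⟨rfl, rfl⟩ := opr_inj.1 h
    exact ⟨x, hx, y, hy, rfl, h'⟩
  · rintro ⟨x, hx, y, hy, rfl, h⟩
    exact ⟨⟨x, hx, y, hy, rfl⟩, x, y, rfl, h⟩

theorem IsChain.app {l r x y : V} (h : IsChain l r) :
    App r x y ↔ x ε suc l ∧ y ε suc l ∧ chainRel l x y := by
  rw [app_iff, h]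
  constructor
  · rintro ⟨x', hx, y', hy, e, h⟩
    obtain ⟨rfl, rfl⟩ := opr_inj.1 e
    exact ⟨hx, hy, h⟩
  · rintro ⟨hx, hy, h⟩
    exact ⟨x, hx, y, hy, rfl, h⟩

/-- The structure `⟨l + 1, r⟩`, without a unary relation and without constants. -/
noncomputable def chain (l r : V) : V := opr (opr (suc l) r) zero

theorem isStr_chain {l r : V} (h : IsChain l r) :
    IsStr false true zero (chain l r) ⟨suc l, zero, r, zero⟩ := by
  refine ⟨⟨_, _, ⟨rfl, not_mem_zero⟩, isOPair_iff.2 rfl, isOPair_iff.2 rfl⟩,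
    fun z hz => absurd hz (not_mem_zero z), fun p hp => ?_, ⟨fun p hp => absurd hp (not_mem_zero p),
      fun p hp => absurd hp (not_mem_zero p)⟩, fun p hp => absurd hp (not_mem_zero p)⟩
  obtain ⟨x, hx, y, hy, hp, -⟩ := (h p).1 hp
  exact ⟨x, hx, y, hy, isOPair_iff.2 hp⟩

theorem IsStr.of_chain {A l r : V} {S : SStr V} (h : IsStr false true A (chain l r) S) :
    S.M = suc l ∧ S.R = r := by
  obtain ⟨⟨y, z, ⟨rfl, -⟩, h1, h2⟩, -⟩ := h
  have h1 := isOPair_iff.1 h1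
  subst h1
  have h2 := isOPair_iff.1 h2
  simp only [chain, opr_inj] at h2
  exact ⟨h2.1.1.symm, h2.1.2.symm⟩

/-- Provides the set of assignments required by `sat_R_var`, separated from ({0} × M) × ({1} × M).
-/
theorem exists_tuples (M r : V) :
    ∃ K, ∀ h, h ε K ↔ ∃ x y, x ε M ∧ y ε M ∧ h = tup x y ∧ App r x y := by
  obtain ⟨c₀, h₀⟩ := EstVP.prod (sng (num 0)) M
  obtain ⟨c₁, h₁⟩ := EstVP.prod (sng (num 1)) M
  obtain ⟨c, hc⟩ := EstVP.prod c₀ c₁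
  obtain ⟨K, hK⟩ := separation
    (C := fun h => ∃ x y, x ε M ∧ y ε M ∧ h = tup x y ∧ App r x y)
    (defClass_of_real (ex fun x => ex fun y => mem x 0 ⋏ mem y 0 ⋏ (ex fun m => ex fun n =>
      ex fun p => ex fun q => isNum 0 m ⋏ isNum 1 n ⋏ isOPair p m x ⋏ isOPair q n y ⋏
        isOPair 2 p q) ⋏ app 1 x y) 2 (update (update (fun _ => M) 0 M) 1 r) fun h => by
      simp (disch := omega) only [real_and, real_ex, real_mem, real_isNum, real_app,
        real_isOPair, update_lt, update_at, isOPair_iff, num_iff]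
      simp [tup]) c
  refine ⟨K, fun h => (hK h).trans (and_iff_right_of_imp ?_)⟩
  rintro ⟨x, y, hx, hy, rfl, -⟩
  simp only [IsProd, isOPair_iff, mem_sng] at h₀ h₁ hc
  exact (hc _).2 ⟨_, (h₀ _).2 ⟨_, rfl, x, hx, rfl⟩, _, (h₁ _).2 ⟨_, rfl, y, hy, rfl⟩, rfl⟩

/-- Elementarity for R(v_0, v_1), at the tuple of x, y and its image. -/
theorem ElemEmb.app_iff {u : Bool} {A f x y x' y' : V} {S T : SStr V}
    (hf : ElemEmb u true A f S T) (hx : x ε S.M) (hy : y ε S.M) (hxx : App f x x')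
    (hyy : App f y y') : App S.R x y ↔ App T.R x' y' := by
  have m0 : (num 0 : V) ε num 2 := by simp [mem_two]
  have m1 : (num 1 : V) ε num 2 := by simp [mem_two]
  have hx' := hf.1.2 x hx x' hxx
  have hy' := hf.1.2 y hy y' hyy
  have h := hf.2.2.2 (num 2) (isNat_num 2) _
    (isFormula_R u (isTerm_var (A := A) m0) (isTerm_var m1)) (tup x y) (tup x' y')
    ⟨tuple_two.2 ⟨x, y, hx, hy, rfl⟩, tuple_two.2 ⟨x', y', hx', hy', rfl⟩, ?_⟩
  · rwa [sat_R_var hx hy (exists_tuples S.M S.R), sat_R_var hx' hy' (exists_tuples T.M T.R)] at h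
  · rintro i - z w ⟨hz, hw⟩
    rw [entry_tup] at hz hw
    rcases hz with ⟨rfl, rfl⟩ | ⟨rfl, rfl⟩
    · rcases hw with ⟨-, rfl⟩ | ⟨h, -⟩
      · exact hxx
      · exact absurd (num_inj.1 h) zero_ne_one
    · rcases hw with ⟨h, -⟩ | ⟨-, rfl⟩
      · exact absurd (num_inj.1 h) one_ne_zero
      · exact hyy

theorem zero_mem_suc {l : V} (hl : IsNat l) : zero ε suc l := by
  refine EstVP.ind (fun x => IsNat x ∧ zero ε suc x)
    (defClass_of_real (nat 0 ⋏ ex fun z => ex fun s => isEmpty z ⋏ isSucc s 0 ⋏ mem z s) 0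
      (fun _ => l) fun x => ?_) (fun x => And.left) ⟨isNat_zero, by simp⟩
    (fun x hx h => ⟨hx.suc, mem_suc.2 (Or.inl h.2)⟩) l hl |>.2
  simp (disch := omega) only [real_and, real_ex, real_nat, real_mem, real_isEmpty, real_isSucc,
    update_lt, update_at, emp_iff, isSucc_iff]
  simp

/-- An elementary embedding between chains is the identity, and the chains have equal length. -/
theorem eq_of_elemEmb_chain {A f l r l' r' : V} {S T : SStr V} (hl : IsNat l) (h0 : l ≠ zero)
    (hr : IsChain l r) (hr' : IsChain l' r') (hS : S.M = suc l ∧ S.R = r)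
    (hT : T.M = suc l' ∧ T.R = r') (hf : ElemEmb false true A f S T) : l = l' := by
  have ex : ∀ x, x ε suc l → ∃ y, App f x y := fun x hx =>
    (hf.1.1.2 x (hS.1 ▸ hx)).imp fun y hy => hy.1
  have key : ∀ x y x' y', x ε suc l → y ε suc l → App f x x' → App f y y' →
      chainRel l x y → chainRel l' x' y' := by
    intro x y x' y' hx hy hxx hyy h
    have := (hf.app_iff (hS.1 ▸ hx) (hS.1 ▸ hy) hxx hyy).1 (by rw [hS.2, hr.app]; exact ⟨hx, hy, h⟩)
    rw [hT.2, hr'.app] at this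
    exact this.2.2
  have z0 := zero_mem_suc hl
  -- The loop at 0 goes to a loop, and 0 carries the only one, as no y equals y ∪ {y}.
  have f0 : App f zero zero := by
    obtain ⟨y, hy⟩ := ex zero z0
    rcases key zero zero y y z0 z0 hy hy (Or.inr ⟨rfl, Or.inl rfl⟩) with h | ⟨rfl, -⟩
    · exact absurd h (suc_ne_self y)
    · exact hy
  -- The conjunct `IsNat x` is there because induction along ω is stated for subclasses of ω. In the
  -- successor step, the pair ⟨x, x + 1⟩ goes to a pair that starts at x; the end point 0 is
  -- excluded by injectivity.
  have hid : ∀ x, IsNat x → IsNat x ∧ (x ε suc l → App f x x) := by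
    refine EstVP.ind _ (defClass_of_real (nat 2 ⋏ (mem 2 0 ⟶ₛ app 1 2 2)) 2
      (update (update (fun _ => l) 0 (suc l)) 1 f) fun x => ?_) (fun x => And.left)
      ⟨isNat_zero, fun _ => f0⟩ fun x hx h => ⟨hx.suc, fun hs => ?_⟩
    · simp (disch := omega) only [real_and, real_nat, real_mem, real_imp, real_app, update_lt,
        update_at]
    · have hxl : x ε suc l := hl.suc.1.1 _ hs x (by simp)
      obtain ⟨y, hy⟩ := ex _ hs
      rcases key x (suc x) x y hxl hs (h.2 hxl) hy (Or.inl rfl) with rfl | ⟨rfl, -⟩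
      · exact hy
      · exact absurd (hf.2.1 _ _ _ ⟨hy, f0⟩) (suc_ne_zero x)
  have hll : l ε suc l := by simp
  -- The pair ⟨l, 0⟩ is fixed, and in the target only 0 and l' are related to 0.
  rcases key l zero l zero hll z0 ((hid l hl).2 hll) f0 (Or.inr ⟨rfl, Or.inr rfl⟩) with h | ⟨-, h⟩
  · exact absurd h (zero_ne_suc l)
  · exact h.resolve_left h0

theorem infinity : ∃ x : V, zero ε x ∧ ∀ y, y ε x → suc y ε x := by
  by_contra hinf
  obtain ⟨x, y, hne, ⟨l, r, hl, h0, hr, rfl⟩, ⟨l', r', -, -, hr', rfl⟩, S, T, hS, hT, f, hf⟩ :=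
    EstVP.vopenka false true (zero : V)
      -- For l = 0 the pair ⟨l, 0⟩ would coincide with the loop and not mark the end of the chain.
      (fun X => ∃ l r, IsNat l ∧ l ≠ zero ∧ IsChain l r ∧ X = chain l r)
      (defClass_of_real (ex fun l => ex fun r => nat l ⋏ neg (isEmpty l) ⋏ (ex fun m =>
          isSucc m l ⋏ all fun p => mem p r ⟷ₛ exIn m fun x => exIn m fun y => isOPair p x y ⋏
            (isSucc y x ⋎ (isEmpty y ⋏ (isEmpty x ⋎ eq x l)))) ⋏
          ex fun m => ex fun q => ex fun z => isSucc m l ⋏ isOPair q m r ⋏ isEmpty z ⋏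
            isOPair 0 q z) 0 (fun _ => zero) fun X => by
        simp (disch := omega) only [real_and, real_ex, real_or, real_eq, real_isEmpty, real_isSucc,
          real_nat, real_neg, real_all, real_iff, real_mem, real_exIn,
          real_isOPair, update_lt, update_at, isOPair_iff, isSucc_iff, emp_iff]
        simp [IsChain, chainRel, chain])
      (by
        rintro _ ⟨l, r, -, -, hr, rfl⟩
        exact ⟨_, isStr_chain hr⟩)
      (by
        rintro ⟨b, hb⟩
        -- If the chains form a set b, every nonzero l ∈ ω lies in the domain l + 1 of its chain,
        -- hence in the fivefold union of b. Adding 0 and separating gives ω, which would witness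
        -- Infinity.
        obtain ⟨w, hw⟩ := separation (C := fun x : V => IsNat x)
          (defClass_of_real (nat 0) 0 (fun _ => zero) fun x => by
            simp (disch := omega) only [real_nat, update_at])
          (un (sng zero) (sUn (sUn (sUn (sUn (sUn b))))))
        refine hinf ⟨w, (hw _).2 ⟨by simp, isNat_zero⟩, fun y hy => (hw _).2 ?_⟩
        have hn := ((hw y).1 hy).2.suc
        obtain ⟨r, hr⟩ := exists_isChain (suc y)
        have h := (mem_sUn_of_opr (mem_sUn_of_opr
          ((hb _).2 ⟨suc y, r, hn, suc_ne_zero y, hr, rfl⟩)).1).1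
        exact ⟨mem_un.2 (Or.inr (mem_sUn.2 ⟨_, h, by simp⟩)), hn⟩)
  obtain rfl := eq_of_elemEmb_chain hl h0 hr hr' hS.of_chain hT.of_chain hf
  obtain rfl : r = r' := set_ext fun p => (hr p).trans (hr' p).symm
  exact hne rfl

end Vopenka

/-! ## The axioms in a model -/

section Models

variable {V : Type*} [setLang.Structure V] [Nonempty V]

open Function (update)
open Fm

theorem models_extAx : V ⊨ extAx ↔ ∀ x y : V, (∀ z, z ε x ↔ z ε y) → x = y := by
  simp (disch := omega) only [extAx, models_close, real_all, real_imp, real_iff, real_mem, real_eq,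
    update_lt, update_at, forall_const]

theorem models_emptyAx : V ⊨ emptyAx ↔ ∃ x : V, Emp x := by
  simp (disch := omega) only [emptyAx, models_close, real_ex, real_isEmpty, update_at, forall_const]

theorem models_pairAx : V ⊨ pairAx ↔ ∀ x y : V, ∃ p, IsPair p x y := by
  simp (disch := omega) only [pairAx, models_close, real_all, real_ex, real_isPair, update_lt,
    update_at, forall_const]

theorem models_unionAx :
    V ⊨ unionAx ↔ ∀ x : V, ∃ w, ∀ z, z ε w ↔ ∃ y, y ε x ∧ z ε y := by
  simp (disch := omega) only [unionAx, models_close, real_all, real_ex, real_iff, real_mem,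
    real_exIn, update_lt, update_at, forall_const]

theorem models_cartProdAx : V ⊨ cartProdAx ↔ ∀ a b : V, ∃ c, IsProd c a b := by
  simp (disch := omega) only [cartProdAx, models_close, real_all, real_ex, real_isProd, update_lt,
    update_at, forall_const]

theorem models_powAx : V ⊨ powAx ↔ ∀ x : V, ∃ w, ∀ z, z ε w ↔ Sub z x := by
  simp (disch := omega) only [powAx, models_close, real_all, real_ex, real_iff, real_mem,
    real_sub, update_lt, update_at, forall_const]

theorem models_infAx : V ⊨ infAx ↔
    ∃ x : V, (∃ z, z ε x ∧ Emp z) ∧ ∀ y, y ε x → ∃ z, z ε x ∧ IsSucc z y := by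
  simp (disch := omega) only [infAx, models_close, real_ex, real_and, real_exIn, real_allIn,
    real_isEmpty, real_isSucc, update_lt, update_at, forall_const]

theorem models_foundAx : V ⊨ foundAx ↔
    ∀ x : V, ¬ Emp x → ∃ y, y ε x ∧ ∀ z, z ε x → ¬ z ε y := by
  simp (disch := omega) only [foundAx, models_close, real_all, real_imp, real_neg, real_exIn,
    real_allIn, real_isEmpty, real_mem, update_lt, update_at, forall_const]

theorem models_sepAx {k : ℕ} (φ : setLang.Formula (Fin k ⊕ Fin 1)) : V ⊨ sepAx φ ↔
    ∀ (v : ℕ → V) (a : V), ∃ b, ∀ x, x ε b ↔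
      x ε a ∧ φ.Realize (Sum.elim (fun i : Fin k => v i) ![x]) := by
  simp (disch := omega) only [sepAx, models_close, real_all, real_ex, real_iff, real_and, real_mem,
    real_at₁, update_lt, update_at]

theorem models_repAx {k : ℕ} (φ : setLang.Formula (Fin k ⊕ Fin 2)) : V ⊨ repAx φ ↔
    ∀ (v : ℕ → V) (a : V),
      (∀ x, x ε a → ∀ y z, φ.Realize (Sum.elim (fun i : Fin k => v i) ![x, y]) ∧
        φ.Realize (Sum.elim (fun i : Fin k => v i) ![x, z]) → y = z) →
      ∃ b, ∀ y, y ε b ↔ ∃ x, x ε a ∧ φ.Realize (Sum.elim (fun i : Fin k => v i) ![x, y]) := by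
  simp (disch := omega) only [repAx, models_close, real_all, real_ex, real_iff, real_and, real_mem,
    real_allIn, real_exIn, real_imp, real_eq, real_at₂, update_lt, update_at]

/-- Stated for any predicate C equivalent to φ, so that definable classes can be plugged in without
rewriting under `Realize`. -/
theorem models_indAx {k : ℕ} (φ : setLang.Formula (Fin k ⊕ Fin 1)) : V ⊨ indAx φ ↔
    ∀ v : ℕ → V, ∀ C : V → Prop,
      (∀ x, C x ↔ φ.Realize (Sum.elim (fun i : Fin k => v i) ![x])) →
      (∀ x, C x → IsNat x) →
      ((∀ z, Emp z → C z) ∧ ∀ x, IsNat x → C x → ∀ y, IsSucc y x → C y) →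
      ∀ x, IsNat x → C x := by
  simp (disch := omega) only [indAx, models_close, real_all, real_imp, real_and, real_nat,
    real_isEmpty, real_isSucc, real_at₁, update_lt, update_at]
  refine forall_congr' fun v => ⟨fun h C hC => ?_, fun h => h _ fun x => Iff.rfl⟩
  simpa only [hC] using h

theorem vopenka_of_models (h : V ⊨ VP) (u r : Bool) (A : V) (C : V → Prop) (hC : DefClass C)
    (hstr : ∀ x, C x → ∃ S, IsStr u r A x S) (hproper : ¬ ∃ b, ∀ x, x ε b ↔ C x) :
    ∃ x y, x ≠ y ∧ C x ∧ C y ∧ ∃ S T, IsStr u r A x S ∧ IsStr u r A y T ∧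
      ∃ f, ElemEmb u r A f S T := by
  obtain ⟨k, φ, v, hφ⟩ := hC
  have h := h.realize_of_mem _ ⟨u, r, k, φ, rfl⟩
  simp (disch := omega) only [vopenkaAx, properClass, models_close, real_all, real_ex, real_imp,
    real_and, real_or, real_neg, real_eq, real_mem, real_exStr, real_isStr_mk, real_elemEmb_mk,
    real_at₁, update_lt, update_at] at h
  obtain ⟨x, y, hne, hx, hy, M, U, R, I, M', U', R', I', hS, hT, f, hf⟩ := by
    refine h v A ⟨fun b => ?_, fun x hx => ?_⟩
    -- Properness is written as: every set b differs from the class at some point. If b had no such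
    -- point, it would equal the class.
    · by_contra! hb
      exact hproper ⟨b, fun x => by have := hb x; rw [hφ] at this; tauto⟩
    · obtain ⟨⟨M, U, R, I⟩, hS⟩ := hstr x ((hφ x).1 hx)
      exact ⟨M, U, R, I, hS⟩
  exact ⟨x, y, hne, (hφ x).1 hx, (hφ y).1 hy, _, _, hS, hT, f, hf⟩

/-- A model of `EST + Foundation + VP`. -/
theorem estVP_of_models (h : V ⊨ EST ∪ {foundAx} ∪ VP) : EstVP V := by
  have mem : ∀ σ ∈ EST ∪ {foundAx}, V ⊨ σ := fun σ hσ => h.realize_of_mem σ (Or.inl hσ)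
  have est : ∀ σ ∈ EST, V ⊨ σ := fun σ hσ => mem σ (Or.inl hσ)
  have basic : ∀ σ ∈ ({extAx, emptyAx, pairAx, unionAx, cartProdAx} : setLang.Theory), V ⊨ σ :=
    fun σ hσ => est σ (Or.inl (Or.inl hσ))
  have : SetAx V :=
    { ext := models_extAx.1 (basic _ (by simp))
      empty := models_emptyAx.1 (basic _ (by simp))
      pair := models_pairAx.1 (basic _ (by simp))
      union := models_unionAx.1 (basic _ (by simp))
      found := models_foundAx.1 (mem _ (by simp)) }
  refine { prod := models_cartProdAx.1 (basic _ (by simp)), sep₀ := ?_, ind := ?_, vopenka := ?_ }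
  · intro k φ v hφ a
    obtain ⟨b, hb⟩ := (models_sepAx φ).1 (est _ (Or.inl (Or.inr ⟨k, φ, hφ, rfl⟩)))
      (fun i => if hi : i < k then v ⟨i, hi⟩ else a) a
    exact ⟨b, fun x => by simpa using hb x⟩
  · rintro C ⟨k, φ, v, hφ⟩ h1 h2 h3
    refine (models_indAx φ).1 (est _ (Or.inr ⟨k, φ, rfl⟩)) v C (fun x => (hφ x).symm) h1
      ⟨fun z hz => ?_, fun x hx hC y hy => ?_⟩
    · rwa [emp_iff.1 hz]
    · rw [isSucc_iff.1 hy]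
      exact h3 x hx hC
  · exact vopenka_of_models (h.mono Set.subset_union_right)

theorem models_ZF_of_EST (h : V ⊨ EST ∪ {foundAx} ∪ VP) : V ⊨ ZF := by
  have := estVP_of_models h
  refine (FirstOrder.Language.Theory.model_iff _).2 ?_
  rintro σ ((hσ | ⟨k, φ, rfl⟩) | ⟨k, φ, rfl⟩)
  · simp only [Set.mem_insert_iff, Set.mem_singleton_iff] at hσ
    rcases hσ with rfl | rfl | rfl | rfl | rfl | rfl | rfl
    · exact models_extAx.2 SetAx.ext
    · exact models_emptyAx.2 SetAx.empty
    · exact models_pairAx.2 SetAx.pair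
    · exact models_unionAx.2 SetAx.union
    · exact models_powAx.2 power_set
    · obtain ⟨x, h0, hs⟩ := infinity (V := V)
      exact models_infAx.2 ⟨x, ⟨_, h0, not_mem_zero⟩, fun y hy => ⟨_, hs y hy, isSucc_iff.2 rfl⟩⟩
    · exact models_foundAx.2 SetAx.found
  · exact (models_sepAx φ).2 fun v a => separation ⟨k, φ, v, fun x => Iff.rfl⟩ a
  · exact (models_repAx φ).2 fun v a hf => replacement ⟨k, φ, v, fun x y => Iff.rfl⟩ a
      fun x hx y z hy hz => hf x hx y z ⟨hy, hz⟩

/-- Only the Cartesian product and induction along ω are not among the axioms of `ZF`. Induction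
needs no set ω: a counterexample x yields the nonempty set of counterexamples in x ∪ {x}, and an
∈-minimal one can be neither 0 nor a successor. -/
theorem models_EST_of_ZF (h : V ⊨ ZF) : V ⊨ EST ∪ {foundAx} := by
  have basic : ∀ σ ∈ ({extAx, emptyAx, pairAx, unionAx, powAx, infAx, foundAx} : setLang.Theory),
    V ⊨ σ := fun σ hσ => h.realize_of_mem σ (Or.inl (Or.inl hσ))
  have sep : ∀ (C : V → Prop), DefClass C → ∀ a, ∃ b, ∀ x, x ε b ↔ x ε a ∧ C x := by
    rintro C ⟨k, φ, v, hφ⟩ a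
    simpa only [hφ] using (models_sepAx φ).1 (h.realize_of_mem _ (Or.inl (Or.inr ⟨k, φ, rfl⟩))) v a
  have : SetAx V :=
    { ext := models_extAx.1 (basic _ (by simp))
      empty := models_emptyAx.1 (basic _ (by simp))
      pair := models_pairAx.1 (basic _ (by simp))
      union := models_unionAx.1 (basic _ (by simp))
      found := models_foundAx.1 (basic _ (by simp)) }
  have pow := models_powAx.1 (basic _ (by simp))
  refine (FirstOrder.Language.Theory.model_iff _).2 ?_
  rintro σ (((hσ | ⟨k, φ, -, rfl⟩) | ⟨k, φ, rfl⟩) | hσ)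
  · simp only [Set.mem_insert_iff, Set.mem_singleton_iff] at hσ
    rcases hσ with rfl | rfl | rfl | rfl | rfl
    · exact basic _ (by simp)
    · exact basic _ (by simp)
    · exact basic _ (by simp)
    · exact basic _ (by simp)
    · refine models_cartProdAx.2 fun a b => ?_
      obtain ⟨p, hp⟩ := pow (un a b)
      obtain ⟨q, hq⟩ := pow p
      obtain ⟨c, hc⟩ := sep (fun p => ∃ x, x ε a ∧ ∃ y, y ε b ∧ IsOPair p x y)
        (defClass_of_real (exIn 0 fun x => exIn 1 fun y => isOPair 2 x y) 2
          (update (update (fun _ => a) 0 a) 1 b) fun x => by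
            simp (disch := omega) only [real_exIn, real_isOPair, update_lt, update_at]) q
      refine ⟨c, fun s => (hc s).trans (and_iff_right_of_imp ?_)⟩
      rintro ⟨x, hx, y, hy, hs⟩
      obtain rfl := isOPair_iff.1 hs
      -- The elements {x} and {x, y} of a pair are subsets of a ∪ b, so the pair is in the double
      -- power set.
      refine (hq _).2 fun t ht => (hp t).2 fun z hz => mem_un.2 ?_
      rcases mem_upair.1 ht with rfl | rfl
      · exact Or.inl (mem_sng.1 hz ▸ hx)
      · rcases mem_upair.1 hz with rfl | rfl
        exacts [Or.inl hx, Or.inr hy]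
  · exact h.realize_of_mem _ (Or.inl (Or.inr ⟨k, φ, rfl⟩))
  · refine (models_indAx φ).2 fun v C hC h1 h2 x hx => ?_
    by_contra hx'
    obtain ⟨k', w, Φ, hΦ⟩ :=
      DefClass.exists_real (C := C) ⟨k, φ, v, fun x => (hC x).symm⟩
    obtain ⟨b, hb⟩ := sep (fun x => ¬ C x) (defClass_of_real (neg (Φ k')) k' w fun x => by
      rw [real_neg, hΦ _ _ _ (by omega) (by omega), update_at]
      intro i hi
      rw [update_lt hi]) (suc x)
    obtain ⟨y, hy, hmin⟩ := SetAx.found b fun h => h x ((hb x).2 ⟨by simp, hx'⟩)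
    obtain ⟨hyx, hy⟩ := (hb y).1 hy
    rcases hx.2 y (mem_suc.1 hyx) with h0 | ⟨z, hz, hs⟩
    · exact hy (h2.1 y h0)
    · have hCz : C z := by
        by_contra hCz
        exact hmin z ((hb z).2 ⟨hx.suc.1.1 y hyx z hz, hCz⟩) hz
      exact hy (h2.2 z (h1 z hCz) hCz y hs)
  · exact hσ ▸ basic _ (by simp)

end Models

/-! ### Comparison of the theories -/

theorem consequences_eq {T T' : setLang.Theory}
    (h : ∀ (V : Type) [setLang.Structure V] [Nonempty V], V ⊨ T ↔ V ⊨ T') :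
    consequences T = consequences T' := by
  ext σ
  constructor
  · intro hσ M
    have := (h M).2 inferInstance
    exact hσ (FirstOrder.Language.Theory.ModelType.of T M)
  · intro hσ M
    have := (h M).1 inferInstance
    exact hσ (FirstOrder.Language.Theory.ModelType.of T' M)

theorem models_EST_iff (V : Type) [setLang.Structure V] [Nonempty V] :
    V ⊨ EST ∪ {foundAx} ∪ VP ↔ V ⊨ ZF ∪ VP :=
  ⟨fun h => (models_ZF_of_EST h).union (h.mono Set.subset_union_right),
    fun h => (models_EST_of_ZF (h.mono Set.subset_union_left)).union
      (h.mono Set.subset_union_right)⟩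

end VopenkaEST

theorem mainTheorem4 :
    VopenkaEST.consequences (VopenkaEST.EST ∪ {VopenkaEST.foundAx} ∪ VopenkaEST.VP) =
        VopenkaEST.consequences (VopenkaEST.ZF ∪ VopenkaEST.VP) ∧
      VopenkaEST.consequences
          (VopenkaEST.EST ∪ {VopenkaEST.foundAx} ∪ {VopenkaEST.choiceAx} ∪ VopenkaEST.VP) =
        VopenkaEST.consequences (VopenkaEST.ZFC ∪ VopenkaEST.VP) := by
  refine ⟨VopenkaEST.consequences_eq VopenkaEST.models_EST_iff,
    VopenkaEST.consequences_eq fun V _ _ => ?_⟩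
  -- Choice is moved to the end of both unions, where it splits off as the same condition on the
  -- model.
  rw [Set.union_right_comm, VopenkaEST.ZFC, Set.union_right_comm VopenkaEST.ZF,
    FirstOrder.Language.Theory.model_union_iff, VopenkaEST.models_EST_iff V,
    ← FirstOrder.Language.Theory.model_union_iff]
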